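/- Write $[0,\infty)^2$ and $\mathbb R^2_+=(0,\infty)^2$ for the closed and the open quadrant, and $\partial\mathbb R^2_+$ for the boundary of the latter. Let $\mu$ and $\sigma^2$ be non-negative and globally Lipschitz continuous on $[0,\infty)^2$, with $$\{x\in\mathbb R^2_+ : \sigma(x)=0\}\subset\{x\in\mathbb R^2_+ : \mu(x)=0\}.$$ Let $\mu_s:\partial\mathbb R^2_+\to[0,\infty)$ be bounded and upper semicontinuous with a locally finite set of discontinuities, extended by $0$ to $\mathbb R^2_+$. Set $\phi(x)=(x_1+x_2)\int_0^1\mu(tx)+\mu_s(tx)\,dt$ for $x\in\partial\mathbb R^2_+$ and consider $$\text{(P)}\qquad (U_{x_1}-\mu)_+(U_{x_2}-\mu)_+=\sigma^2\ \text{ on }\mathbb R^2_+,\qquad U=\phi\ \text{ on }\partial\mathbb R^2_+ .$$ For $h>0$ let $U^h_{i,j}$ be the numerical solution of the scheme $$\text{(S)}\qquad U^h_{i,j}=\tfrac12\big(U^h_{i-1,j}+U^h_{i,j-1}\big)+h\mu_{i,j}+\tfrac12\sqrt{\big(U^h_{i-1,j}-U^h_{i,j-1}\big)^2+4h^2\sigma_{i,j}^2}\quad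 (i,j\ge 0),$$ with $U^h_{i,j}=0$ if $i<0$ or $j<0$, where $\mu_{i,j}=\mu(hi,hj)+\mu_s(hi,hj)$ and $\sigma_{i,j}=\sigma(hi,hj)$, and extend it to $[0,\infty)^2$ by $U^h(x)=U^h_{\lfloor h^{-1}x_1\rfloor,\lfloor h^{-1}x_2\rfloor}$. **Theorem.** There is exactly one function $U\in C([0,\infty)^2)$ which is non-decreasing in each variable, is a viscosity solution of the equation in (P) on $\mathbb R^2_+$, and satisfies $U=\phi$ on $\partial\mathbb R^2_+$; and $$U^h\longrightarrow U\quad\text{locally uniformly on }[0,\infty)^2\text{ as }h\to0^+ .$$ Moreover, the scheme has linear complexity: there is an absolute constant $C$ such that, for all $m,n\ge0$, all the values $U^h_{i,j}$ with $0\le i\le m$, $0\le j\le n$ are computed by a straight-line program, depending on $m,n$ only, of at most $C(m+1)(n+1)$ instructions, each of which loads a rational constant, reads one of the input numbers $h$, $\mu_{i,j}$, $\sigma^2_{i,j}$, or performs an addition, subtraction, multiplication or square root of real numbers. -/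

import Mathlib

open Set Filter Topology

/-! Points of the plane are pairs of reals with the coordinatewise order.  Only the Lipschitz
property (with an unspecified constant), continuity and the little-o relation refer to the norm,
so it makes no difference which norm of the plane is used. -/

/-- The closed quadrant `[0,∞)²`. -/
def closedQuadrant : Set (ℝ × ℝ) := {x | 0 ≤ x.1 ∧ 0 ≤ x.2}

/-- The open quadrant `(0,∞)²`. -/
def openQuadrant : Set (ℝ × ℝ) := {x | 0 < x.1 ∧ 0 < x.2}

/-- The topological boundary of the open quadrant: the two nonnegative half-axes. -/
def quadrantBoundary : Set (ℝ × ℝ) := {x | 0 ≤ x.1 ∧ 0 ≤ x.2 ∧ (x.1 = 0 ∨ x.2 = 0)}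

/-! ### Viscosity solutions of `H(x, Du) = 0` on an open set `O` -/

/-- `p ∈ D⁺u(x)`: `u(y) ≤ u(x) + ⟨p, y - x⟩ + o(|y - x|)` as `O ∋ y → x`. -/
def IsSuperdifferential (O : Set (ℝ × ℝ)) (u : ℝ × ℝ → ℝ) (x p : ℝ × ℝ) : Prop :=
  ∀ ε : ℝ, 0 < ε → ∀ᶠ y in 𝓝[O] x,
    u y ≤ u x + (p.1 * (y.1 - x.1) + p.2 * (y.2 - x.2)) + ε * ‖y - x‖

/-- `p ∈ D⁻u(x)`: `u(y) ≥ u(x) + ⟨p, y - x⟩ + o(|y - x|)` as `O ∋ y → x`. -/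
def IsSubdifferential (O : Set (ℝ × ℝ)) (u : ℝ × ℝ → ℝ) (x p : ℝ × ℝ) : Prop :=
  ∀ ε : ℝ, 0 < ε → ∀ᶠ y in 𝓝[O] x,
    u x + (p.1 * (y.1 - x.1) + p.2 * (y.2 - x.2)) - ε * ‖y - x‖ ≤ u y

/-- Viscosity subsolution: `u ∈ USC(O)` and `liminf_{y → x} H(y,p) ≤ 0` for `p ∈ D⁺u(x)`.
The envelope is taken in the extended reals. -/
def IsViscositySubsolution (H : ℝ × ℝ → ℝ × ℝ → ℝ) (O : Set (ℝ × ℝ)) (u : ℝ × ℝ → ℝ) : Prop :=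
  UpperSemicontinuousOn u O ∧
    ∀ x ∈ O, ∀ p : ℝ × ℝ, IsSuperdifferential O u x p →
      liminf (fun y => (H y p : EReal)) (𝓝[O] x) ≤ 0

/-- Viscosity supersolution: `u ∈ LSC(O)` and `limsup_{y → x} H(y,p) ≥ 0` for `p ∈ D⁻u(x)`. -/
def IsViscositySupersolution (H : ℝ × ℝ → ℝ × ℝ → ℝ) (O : Set (ℝ × ℝ)) (u : ℝ × ℝ → ℝ) : Prop :=
  LowerSemicontinuousOn u O ∧
    ∀ x ∈ O, ∀ p : ℝ × ℝ, IsSubdifferential O u x p →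
      0 ≤ limsup (fun y => (H y p : EReal)) (𝓝[O] x)

/-- A viscosity solution is both a sub- and a supersolution. -/
def IsViscositySolution (H : ℝ × ℝ → ℝ × ℝ → ℝ) (O : Set (ℝ × ℝ)) (u : ℝ × ℝ → ℝ) : Prop :=
  IsViscositySubsolution H O u ∧ IsViscositySupersolution H O u

/-! ### The Hamilton-Jacobi boundary value problem -/

/-- The source hypothesis: `μs : ∂(0,∞)² → [0,∞)` is bounded and upper semicontinuous, and its
set of discontinuities (as a function on the boundary) is locally finite.  Values of `μs` off the
boundary play no role. -/
structure IsAdmissibleSource (μs : ℝ × ℝ → ℝ) : Prop where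
  nonneg : ∀ x ∈ quadrantBoundary, 0 ≤ μs x
  bounded : ∃ M : ℝ, ∀ x ∈ quadrantBoundary, μs x ≤ M
  usc : UpperSemicontinuousOn μs quadrantBoundary
  discontinuities : ∀ x ∈ quadrantBoundary, ∃ V ∈ 𝓝 x,
    {y ∈ V ∩ quadrantBoundary | ¬ ContinuousWithinAt μs quadrantBoundary y}.Finite

/-- The total weight `μ + μs`, where `μs` is extended by zero off the boundary. -/
noncomputable def totalWeight (μ μs : ℝ × ℝ → ℝ) (x : ℝ × ℝ) : ℝ :=
  μ x + quadrantBoundary.indicator μs x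

/-- `H(x,p) = (p₁ - μ(x))₊ (p₂ - μ(x))₊ - σ(x)²`. -/
noncomputable def hamiltonian (μ σ : ℝ × ℝ → ℝ) (x p : ℝ × ℝ) : ℝ :=
  max (p.1 - μ x) 0 * max (p.2 - μ x) 0 - σ x ^ 2

/-- `φ(x) = (x₁ + x₂) ∫₀¹ μ(tx) + μs(tx) dt`. -/
noncomputable def boundaryDatum (μ μs : ℝ × ℝ → ℝ) (x : ℝ × ℝ) : ℝ :=
  (x.1 + x.2) * ∫ t in (0 : ℝ)..1, totalWeight μ μs (t • x)

/-- `U` is a monotone viscosity solution of the problem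
`(U_{x₁} - μ)₊ (U_{x₂} - μ)₊ = σ²` on `(0,∞)²`, `U = φ` on `∂(0,∞)²`,
continuous up to the boundary.  Values of `U` off `[0,∞)²` play no role. -/
structure IsMonotoneViscositySolution (μ μs σ U : ℝ × ℝ → ℝ) : Prop where
  monotone : MonotoneOn U closedQuadrant
  continuous : ContinuousOn U closedQuadrant
  solves : IsViscositySolution (hamiltonian μ σ) openQuadrant U
  boundary : ∀ x ∈ quadrantBoundary, U x = boundaryDatum μ μs x

/-! ### The numerical scheme -/

/-- The update formula: the new value from the left neighbour `a`, the lower neighbour `b`, the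
grid spacing `h`, the weight `m` and the variance `v` at the grid point. -/
noncomputable def schemeUpdate (h m v a b : ℝ) : ℝ :=
  (1 / 2) * (a + b) + h * m + (1 / 2) * Real.sqrt ((a - b) ^ 2 + 4 * h ^ 2 * v)

/-- The numerical solution `U^h_{i,j}` on the grid `hℕ₀²`; neighbours off the grid have value 0. -/
noncomputable def schemeValue (μ μs σ : ℝ × ℝ → ℝ) (h : ℝ) : ℕ → ℕ → ℝ
  | 0, 0 => schemeUpdate h (totalWeight μ μs (0, 0)) (σ (0, 0) ^ 2) 0 0
  | 0, j + 1 =>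
      schemeUpdate h (totalWeight μ μs (0, h * ((j + 1 : ℕ) : ℝ)))
        (σ (0, h * ((j + 1 : ℕ) : ℝ)) ^ 2) 0 (schemeValue μ μs σ h 0 j)
  | i + 1, 0 =>
      schemeUpdate h (totalWeight μ μs (h * ((i + 1 : ℕ) : ℝ), 0))
        (σ (h * ((i + 1 : ℕ) : ℝ), 0) ^ 2) (schemeValue μ μs σ h i 0) 0
  | i + 1, j + 1 =>
      schemeUpdate h (totalWeight μ μs (h * ((i + 1 : ℕ) : ℝ), h * ((j + 1 : ℕ) : ℝ)))
        (σ (h * ((i + 1 : ℕ) : ℝ), h * ((j + 1 : ℕ) : ℝ)) ^ 2)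
        (schemeValue μ μs σ h i (j + 1)) (schemeValue μ μs σ h (i + 1) j)
termination_by i j => i + j

/-- The scheme as a system of equations for a function on `ℤ²`. -/
def SolvesScheme (μ μs σ : ℝ × ℝ → ℝ) (h : ℝ) (u : ℤ → ℤ → ℝ) : Prop :=
  ∀ i j : ℤ,
    (0 ≤ i ∧ 0 ≤ j →
      u i j = (1 / 2) * (u (i - 1) j + u i (j - 1)) + h * totalWeight μ μs (h * i, h * j)
        + (1 / 2) * Real.sqrt ((u (i - 1) j - u i (j - 1)) ^ 2 + 4 * h ^ 2 * σ (h * i, h * j) ^ 2)) ∧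
    (¬ (0 ≤ i ∧ 0 ≤ j) → u i j = 0)

/-- The recursion computes the one and only solution of the system of equations. -/
theorem solvesScheme_iff (μ μs σ : ℝ × ℝ → ℝ) (h : ℝ) (u : ℤ → ℤ → ℝ) :
    SolvesScheme μ μs σ h u ↔
      ∀ i j : ℤ, u i j =
        if 0 ≤ i ∧ 0 ≤ j then schemeValue μ μs σ h i.toNat j.toNat else 0 := by
  constructor
  · intro hu
    have key : ∀ n i j : ℕ, i + j = n → u i j = schemeValue μ μs σ h i j := by
      intro n
      induction n using Nat.strong_induction_on with
      | _ n ih =>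
        intro i j hij
        have e := (hu i j).1 ⟨by positivity, by positivity⟩
        rw [e]
        rcases i with _ | i <;> rcases j with _ | j
        · have e1 := (hu (-1) 0).2 (by norm_num)
          have e2 := (hu 0 (-1)).2 (by norm_num)
          simp [schemeValue, schemeUpdate, e1, e2]
        · have e1 := (hu (-1) ((j + 1 : ℕ) : ℤ)).2 (by norm_num)
          have e2 := ih (0 + j) (by omega) 0 j rfl
          have e3 : (((j + 1 : ℕ) : ℤ)) - 1 = (j : ℤ) := by push_cast; ring
          simp only [schemeValue, schemeUpdate]
          rw [← e2, e3]
          simp only [Nat.cast_zero, zero_sub, e1]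
          simp
        · have e1 := (hu ((i + 1 : ℕ) : ℤ) (-1)).2 (by norm_num)
          have e2 := ih (i + 0) (by omega) i 0 rfl
          have e3 : (((i + 1 : ℕ) : ℤ)) - 1 = (i : ℤ) := by push_cast; ring
          simp only [schemeValue, schemeUpdate]
          rw [← e2, e3]
          simp only [Nat.cast_zero, zero_sub, e1]
          simp
        · have e1 := ih (i + (j + 1)) (by omega) i (j + 1) rfl
          have e2 := ih ((i + 1) + j) (by omega) (i + 1) j rfl
          have e3 : (((i + 1 : ℕ) : ℤ)) - 1 = (i : ℤ) := by push_cast; ring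
          have e4 : (((j + 1 : ℕ) : ℤ)) - 1 = (j : ℤ) := by push_cast; ring
          simp only [schemeValue, schemeUpdate]
          rw [← e1, ← e2, e3, e4]
          simp
    intro i j
    split_ifs with hp
    · obtain ⟨a, rfl⟩ := Int.eq_ofNat_of_zero_le hp.1
      obtain ⟨b, rfl⟩ := Int.eq_ofNat_of_zero_le hp.2
      simpa using key _ a b rfl
    · exact (hu i j).2 hp
  · intro hu i j
    refine ⟨fun hp => ?_, fun hp => by rw [hu, if_neg hp]⟩
    obtain ⟨a, rfl⟩ := Int.eq_ofNat_of_zero_le hp.1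
    obtain ⟨b, rfl⟩ := Int.eq_ofNat_of_zero_le hp.2
    rw [hu a b, hu (a - 1) b, hu a (b - 1)]
    have pos : ∀ k : ℕ, (0 : ℤ) ≤ (k : ℤ) + 1 := fun k => by omega
    rcases a with _ | a <;> rcases b with _ | b
    · simp [schemeValue, schemeUpdate]
    · simp [schemeValue, schemeUpdate, pos]
    · simp [schemeValue, schemeUpdate, pos]
    · simp [schemeValue, schemeUpdate, pos]

/-- The extension `U^h(x) = U^h_{⌊x₁/h⌋,⌊x₂/h⌋}` of the numerical solution to `[0,∞)²`. -/
noncomputable def schemeExtension (μ μs σ : ℝ × ℝ → ℝ) (h : ℝ) (x : ℝ × ℝ) : ℝ :=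
  schemeValue μ μs σ h ⌊h⁻¹ * x.1⌋₊ ⌊h⁻¹ * x.2⌋₊

/-! ### Arithmetic complexity of the scheme

The cost model is the straight-line program over the reals: every instruction appends one number
to the memory, and the cost is the number of instructions. -/

/-- The input data of the scheme: the spacing, and the weight and variance at each grid point. -/
inductive GridInput : Type
  | spacing : GridInput
  | weight : ℕ → ℕ → GridInput
  | variance : ℕ → ℕ → GridInput

/-- Instructions; the natural numbers are addresses of earlier results in the memory. -/
inductive ArithInstr : Type
  | const : ℚ → ArithInstr
  | input : GridInput → ArithInstr
  | add : ℕ → ℕ → ArithInstr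
  | sub : ℕ → ℕ → ArithInstr
  | mul : ℕ → ℕ → ArithInstr
  | sqrt : ℕ → ArithInstr

/-- The number computed by one instruction. -/
noncomputable def ArithInstr.eval (d : GridInput → ℝ) (mem : List ℝ) : ArithInstr → ℝ
  | .const q => (q : ℝ)
  | .input k => d k
  | .add a b => mem.getD a 0 + mem.getD b 0
  | .sub a b => mem.getD a 0 - mem.getD b 0
  | .mul a b => mem.getD a 0 * mem.getD b 0
  | .sqrt a => Real.sqrt (mem.getD a 0)

/-- The memory after running a program, starting from the empty memory. -/
noncomputable def runProgram (d : GridInput → ℝ) (P : List ArithInstr) : List ℝ :=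
  P.foldl (fun mem c => mem ++ [c.eval d mem]) []

/-- The values of the input data: `h`, `μ(hi,hj) + μs(hi,hj)` and `σ(hi,hj)²`. -/
noncomputable def schemeInput (μ μs σ : ℝ × ℝ → ℝ) (h : ℝ) : GridInput → ℝ
  | .spacing => h
  | .weight i j => totalWeight μ μs (h * i, h * j)
  | .variance i j => σ (h * i, h * j) ^ 2

/-- The scheme has linear complexity: there is an absolute constant `C` such that on every grid
`{0,…,m} × {0,…,n}` a program with at most `C (m+1)(n+1)` instructions, which does not depend on
the data, computes all the values `U^h_{i,j}` (the value at `(i,j)` is found at address `a i j`). -/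
def SchemeHasLinearComplexity : Prop :=
  ∃ C : ℕ, ∀ m n : ℕ, ∃ (P : List ArithInstr) (a : ℕ → ℕ → ℕ),
    P.length ≤ C * ((m + 1) * (n + 1)) ∧
    ∀ (μ μs σ : ℝ × ℝ → ℝ) (h : ℝ), 0 < h → ∀ i j : ℕ, i ≤ m → j ≤ n →
      (runProgram (schemeInput μ μs σ h) P)[a i j]? = some (schemeValue μ μs σ h i j)

/-!
The scheme is monotone and consistent, so its relaxed limits as `h → 0`, the upper `U⁺` and the
lower `U⁻ ≤ U⁺`, are a sub- and a supersolution; a comparison principle for semicontinuous functions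
then gives `U⁺ ≤ U⁻`.  Hence both are one continuous function `U`, which solves the problem and to
which the scheme converges locally uniformly.  The same comparison principle gives uniqueness.

Comparison (`le_of_subsolution_of_supersolution`) is proved by doubling the variables.  For a
monotone supersolution every subgradient `q` satisfies `q₁, q₂ ≥ μ`: where `σ ≠ 0` by the equation,
where `σ = 0` because `μ = 0` there and `q ≥ 0`.  Adding a function with positive partial
derivatives therefore makes a supersolution strict.  An increasing exponential does this and also
keeps the maximum of the doubled function away from the outer sides of a square, so that no
condition at infinity is needed.

For the relaxed limits (`exists_gridPoint_backward_difference_ge`), a supergradient `p` of `U⁺` at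
`x` is tested with the cone `p · (y - x) + 2 ε ‖y - x‖`.  The scheme only involves differences of
neighbouring values, so a Lipschitz test function is good enough.  In terms of backward differences
the scheme reads `(D₁U - hμ) (D₂U - hμ) = h² σ²` with non-negative factors.

For the boundary values, the scheme accumulates at least the weights along an axis, which bounds
`U⁻` from below.  From above there is the explicit supersolution `schemeBarrier`: the sums of the
weights along both axes, a multiple of `x₁ x₂` that compensates for the variation of `μ`, and
`2 s √(x₁ x₂)`, whose partial derivatives have product `s²`.  Finally the sums along the axes
converge to integrals by dominated convergence, since a locally finite set of discontinuities is a
null set (`tendsto_sum_totalWeight_axis`).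

Linear complexity holds because each grid point costs fifteen instructions.
-/

/-! ### Pointwise form of the viscosity inequalities -/

theorem isOpen_openQuadrant : IsOpen openQuadrant :=
  (isOpen_lt continuous_const continuous_fst).inter (isOpen_lt continuous_const continuous_snd)

theorem openQuadrant_subset_closedQuadrant : openQuadrant ⊆ closedQuadrant :=
  fun _ hx => ⟨hx.1.le, hx.2.le⟩

theorem mem_quadrantBoundary_of_notMem {x : ℝ × ℝ} (hx : x ∈ closedQuadrant)
    (h : x ∉ openQuadrant) : x ∈ quadrantBoundary := by
  refine ⟨hx.1, hx.2, ?_⟩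
  by_contra! hne
  exact h ⟨lt_of_le_of_ne hx.1 hne.1.symm, lt_of_le_of_ne hx.2 hne.2.symm⟩

theorem quadrantBoundary_subset_closedQuadrant : quadrantBoundary ⊆ closedQuadrant :=
  fun _ hx => ⟨hx.1, hx.2.1⟩

/-- Joint continuity of the Hamiltonian: it turns the envelopes in the definition of viscosity
solutions into values, and lets the inequalities of the scheme pass to the limit. -/
theorem tendsto_hamiltonian {μ σ : ℝ × ℝ → ℝ} (hμ : ContinuousOn μ closedQuadrant)
    (hσ : ContinuousOn (fun x => σ x ^ 2) closedQuadrant) {x : ℝ × ℝ} (hx : x ∈ openQuadrant)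
    (p : ℝ × ℝ) :
    Tendsto (fun z : (ℝ × ℝ) × (ℝ × ℝ) => hamiltonian μ σ z.1 z.2) (𝓝 (x, p))
      (𝓝 (hamiltonian μ σ x p)) := by
  have hQ : closedQuadrant ∈ 𝓝 x :=
    mem_of_superset (isOpen_openQuadrant.mem_nhds hx) openQuadrant_subset_closedQuadrant
  have h1 : ContinuousAt (fun z : (ℝ × ℝ) × (ℝ × ℝ) => μ z.1) (x, p) :=
    ContinuousAt.comp (f := fun z : (ℝ × ℝ) × (ℝ × ℝ) => z.1) (hμ.continuousAt hQ)
      continuousAt_fst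
  have h2 : ContinuousAt (fun z : (ℝ × ℝ) × (ℝ × ℝ) => σ z.1 ^ 2) (x, p) :=
    ContinuousAt.comp (g := fun x => σ x ^ 2) (f := fun z : (ℝ × ℝ) × (ℝ × ℝ) => z.1)
      (hσ.continuousAt hQ) continuousAt_fst
  have h3 : ContinuousAt (fun z : (ℝ × ℝ) × (ℝ × ℝ) => z.2.1) (x, p) := by fun_prop
  have h4 : ContinuousAt (fun z : (ℝ × ℝ) × (ℝ × ℝ) => z.2.2) (x, p) := by fun_prop
  exact (((h3.sub h1).max continuousAt_const).mul ((h4.sub h1).max continuousAt_const)).sub h2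

theorem tendsto_hamiltonian_coe {μ σ : ℝ × ℝ → ℝ} (hμ : ContinuousOn μ closedQuadrant)
    (hσ : ContinuousOn (fun x => σ x ^ 2) closedQuadrant) {x : ℝ × ℝ} (hx : x ∈ openQuadrant)
    (p : ℝ × ℝ) :
    Tendsto (fun y => (hamiltonian μ σ y p : EReal)) (𝓝[openQuadrant] x)
      (𝓝 (hamiltonian μ σ x p : EReal)) := by
  refine (continuous_coe_real_ereal.tendsto _).comp ?_
  have hc : Tendsto (fun y : ℝ × ℝ => (y, p)) (𝓝[openQuadrant] x) (𝓝 (x, p)) :=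
    (Continuous.tendsto' (by fun_prop) _ _ rfl).mono_left nhdsWithin_le_nhds
  exact (tendsto_hamiltonian hμ hσ hx p).comp hc

theorem isViscositySubsolution_hamiltonian_iff {μ σ u : ℝ × ℝ → ℝ}
    (hμ : ContinuousOn μ closedQuadrant)
    (hσ : ContinuousOn (fun x => σ x ^ 2) closedQuadrant) :
    IsViscositySubsolution (hamiltonian μ σ) openQuadrant u ↔
      UpperSemicontinuousOn u openQuadrant ∧ ∀ x ∈ openQuadrant, ∀ p,
        IsSuperdifferential openQuadrant u x p → hamiltonian μ σ x p ≤ 0 := by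
  refine and_congr Iff.rfl (forall₂_congr fun x hx => forall₂_congr fun p _ => ?_)
  have : (𝓝[openQuadrant] x).NeBot := mem_closure_iff_nhdsWithin_neBot.1 (subset_closure hx)
  rw [(tendsto_hamiltonian_coe hμ hσ hx p).liminf_eq]
  exact_mod_cast Iff.rfl

theorem isViscositySupersolution_hamiltonian_iff {μ σ u : ℝ × ℝ → ℝ}
    (hμ : ContinuousOn μ closedQuadrant)
    (hσ : ContinuousOn (fun x => σ x ^ 2) closedQuadrant) :
    IsViscositySupersolution (hamiltonian μ σ) openQuadrant u ↔
      LowerSemicontinuousOn u openQuadrant ∧ ∀ x ∈ openQuadrant, ∀ p,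
        IsSubdifferential openQuadrant u x p → 0 ≤ hamiltonian μ σ x p := by
  refine and_congr Iff.rfl (forall₂_congr fun x hx => forall₂_congr fun p _ => ?_)
  have : (𝓝[openQuadrant] x).NeBot := mem_closure_iff_nhdsWithin_neBot.1 (subset_closure hx)
  rw [(tendsto_hamiltonian_coe hμ hσ hx p).limsup_eq]
  exact_mod_cast Iff.rfl

/-! ### Comparison principle -/

/-- Doubling of variables: the maxima of `u x - w y - n/2 |x - y|²` accumulate, as `n → ∞`, at a
diagonal point where `u - w` is maximal, and the penalty term vanishes in the limit. -/
theorem exists_doubling_point {K : Set (ℝ × ℝ)} (hK : IsCompact K) {u w : ℝ × ℝ → ℝ}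
    (hu : UpperSemicontinuousOn u K) (hw : LowerSemicontinuousOn w K) (hne : K.Nonempty) :
    ∃ z ∈ K, (∀ x ∈ K, u x - w x ≤ u z - w z) ∧ ∀ δ > 0, ∃ n : ℝ, 0 < n ∧ ∃ x ∈ K, ∃ y ∈ K,
      ‖x - z‖ < δ ∧ ‖y - z‖ < δ ∧ n * ((x.1 - y.1) ^ 2 + (x.2 - y.2) ^ 2) < δ ∧
      ∀ x' ∈ K, ∀ y' ∈ K, u x' - w y' - n / 2 * ((x'.1 - y'.1) ^ 2 + (x'.2 - y'.2) ^ 2) ≤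
        u x - w y - n / 2 * ((x.1 - y.1) ^ 2 + (x.2 - y.2) ^ 2) := by
  obtain ⟨xu, -, hxu⟩ := hu.exists_isMaxOn hne hK
  obtain ⟨yw, -, hyw⟩ := hw.exists_isMinOn hne hK
  have hmax : ∀ n : ℕ, ∃ q ∈ K ×ˢ K, IsMaxOn (fun q : (ℝ × ℝ) × (ℝ × ℝ) => u q.1 + -w q.2 +
      -((n + 1 : ℝ) / 2 * ((q.1.1 - q.2.1) ^ 2 + (q.1.2 - q.2.2) ^ 2))) (K ×ˢ K) q := by
    intro n
    refine UpperSemicontinuousOn.exists_isMaxOn (hne.prod hne) (hK.prod hK) ?_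
    refine UpperSemicontinuousOn.add (UpperSemicontinuousOn.add ?_ ?_) ?_
    · exact hu.comp continuousOn_fst (fun q hq => hq.1)
    · exact hw.neg.comp continuousOn_snd (fun q hq => hq.2)
    · exact ContinuousOn.upperSemicontinuousOn (by fun_prop)
  choose q hqK hq using hmax
  obtain ⟨⟨z, z'⟩, hz, φ, hφ, hlim⟩ := (hK.prod hK).tendsto_subseq hqK
  have hx : Tendsto (fun n => (q (φ n)).1) atTop (𝓝 z) := (continuous_fst.tendsto _).comp hlim
  have hy : Tendsto (fun n => (q (φ n)).2) atTop (𝓝 z') := (continuous_snd.tendsto _).comp hlim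
  obtain ⟨x₀, hx₀⟩ := hne
  have hval : ∀ n : ℕ, ∀ x' ∈ K, ∀ y' ∈ K,
      u x' - w y' - (n + 1 : ℝ) / 2 * ((x'.1 - y'.1) ^ 2 + (x'.2 - y'.2) ^ 2) ≤
      u (q n).1 - w (q n).2 -
        (n + 1 : ℝ) / 2 * (((q n).1.1 - (q n).2.1) ^ 2 + ((q n).1.2 - (q n).2.2) ^ 2) := by
    intro n x' hx' y' hy'
    have := hq n (show (x', y') ∈ K ×ˢ K from ⟨hx', hy'⟩)
    simp only [mem_ofPred_eq] at this
    linarith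
  have hφn : ∀ n : ℕ, (n : ℝ) ≤ φ n := fun n => by exact_mod_cast hφ.le_apply
  -- the penalty stays bounded, hence the two limits agree
  have hzz : z' = z := by
    set M := u xu - w yw - (u x₀ - w x₀) with hM
    have hb : ∀ n : ℕ, (((q (φ n)).1.1 - (q (φ n)).2.1) ^ 2 +
        ((q (φ n)).1.2 - (q (φ n)).2.2) ^ 2) ≤ 2 * M / (n + 1 : ℝ) := by
      intro n
      rw [le_div_iff₀ (by positivity)]
      have h1 := hval (φ n) x₀ hx₀ x₀ hx₀
      have h2 : u (q (φ n)).1 ≤ u xu := hxu (hqK _).1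
      have h3 : w yw ≤ w (q (φ n)).2 := hyw (hqK _).2
      have h4 := hφn n
      have h5 : 0 ≤ (((q (φ n)).1.1 - (q (φ n)).2.1) ^ 2 +
        ((q (φ n)).1.2 - (q (φ n)).2.2) ^ 2) := by positivity
      simp only [sub_self] at h1
      nlinarith
    have hl : Tendsto (fun n => ((q (φ n)).1.1 - (q (φ n)).2.1) ^ 2 +
        ((q (φ n)).1.2 - (q (φ n)).2.2) ^ 2) atTop
        (𝓝 ((z.1 - z'.1) ^ 2 + (z.2 - z'.2) ^ 2)) :=
      Tendsto.comp (f := fun n => q (φ n))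
        (g := fun q : (ℝ × ℝ) × (ℝ × ℝ) => (q.1.1 - q.2.1) ^ 2 + (q.1.2 - q.2.2) ^ 2)
        (Continuous.tendsto (by fun_prop) ((z, z') : (ℝ × ℝ) × (ℝ × ℝ))) hlim
    have h0 : Tendsto (fun n : ℕ => 2 * M / (n + 1 : ℝ)) atTop (𝓝 0) :=
      tendsto_const_nhds.div_atTop
        (tendsto_atTop_add_const_right _ _ tendsto_natCast_atTop_atTop)
    have := le_of_tendsto_of_tendsto' hl h0 hb
    have e1 : z.1 - z'.1 = 0 := by nlinarith [sq_nonneg (z.1 - z'.1), sq_nonneg (z.2 - z'.2)]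
    have e2 : z.2 - z'.2 = 0 := by nlinarith [sq_nonneg (z.1 - z'.1), sq_nonneg (z.2 - z'.2)]
    exact Prod.ext (by linarith) (by linarith)
  subst hzz
  have hzK := hz.1
  have hxK : ∀ᶠ n in atTop, (q (φ n)).1 ∈ K := Eventually.of_forall fun n => (hqK _).1
  have hyK : ∀ᶠ n in atTop, (q (φ n)).2 ∈ K := Eventually.of_forall fun n => (hqK _).2
  have hev : ∀ δ > 0, ∀ᶠ n in atTop, u (q (φ n)).1 < u z' + δ ∧ w z' - δ < w (q (φ n)).2 := by
    intro δ hδ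
    refine Eventually.and ?_ ?_
    · exact (tendsto_nhdsWithin_iff.2 ⟨hx, hxK⟩).eventually
        (hu z' hzK (u z' + δ) (by linarith))
    · exact (tendsto_nhdsWithin_iff.2 ⟨hy, hyK⟩).eventually
        (hw z' hzK (w z' - δ) (by linarith))
  refine ⟨z', hzK, fun x hx' => ?_, fun δ hδ => ?_⟩
  · refine le_of_forall_pos_le_add fun δ hδ => ?_
    obtain ⟨n, h1, h2⟩ := (hev (δ / 2) (by linarith)).exists
    have h3 := hval (φ n) x hx' x hx'
    have : 0 ≤ ((φ n : ℝ) + 1) / 2 * (((q (φ n)).1.1 - (q (φ n)).2.1) ^ 2 +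
        ((q (φ n)).1.2 - (q (φ n)).2.2) ^ 2) := by positivity
    simp only [sub_self] at h3
    linarith
  · have e1 : ∀ᶠ n in atTop, ‖(q (φ n)).1 - z'‖ < δ := by
      simpa [dist_eq_norm] using (Metric.tendsto_nhds.1 hx) δ hδ
    have e2 : ∀ᶠ n in atTop, ‖(q (φ n)).2 - z'‖ < δ := by
      simpa [dist_eq_norm] using (Metric.tendsto_nhds.1 hy) δ hδ
    obtain ⟨n, ⟨h1, h2⟩, h3, h4⟩ := ((hev (δ / 4) (by linarith)).and (e1.and e2)).exists
    refine ⟨(φ n : ℝ) + 1, by positivity, _, (hqK _).1, _, (hqK _).2, h3, h4, ?_, hval (φ n)⟩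
    have h5 := hval (φ n) z' hzK z' hzK
    simp only [sub_self] at h5
    linarith

theorem eventually_abs_sub_le_of_hasDerivAt {g : ℝ → ℝ} {g' s : ℝ} (hg : HasDerivAt g g' s)
    {ε : ℝ} (hε : 0 < ε) : ∀ᶠ t in 𝓝 s, |g t - g s - g' * (t - s)| ≤ ε * |t - s| := by
  have := (hasDerivAt_iff_isLittleO.1 hg).def hε
  filter_upwards [this] with t ht
  simpa [Real.norm_eq_abs, mul_comm] using ht

theorem sq_add_sq_le_norm_sq (x : ℝ × ℝ) : x.1 ^ 2 + x.2 ^ 2 ≤ 2 * ‖x‖ ^ 2 := by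
  have h1 := norm_fst_le x
  have h2 := norm_snd_le x
  have h3 := sq_abs x.1
  have h4 := sq_abs x.2
  rw [Real.norm_eq_abs] at h1 h2
  nlinarith [abs_nonneg x.1, abs_nonneg x.2]

/-- At a maximum of the doubled function, the gradient of the penalty in the first variable is a
supergradient of the upper function. -/
theorem isSuperdifferential_of_doubling {O K : Set (ℝ × ℝ)} {u : ℝ × ℝ → ℝ} {n : ℝ} (hn : 0 < n)
    {x y : ℝ × ℝ} (hK : K ∈ 𝓝 x)
    (h : ∀ x' ∈ K, u x' - n / 2 * ((x'.1 - y.1) ^ 2 + (x'.2 - y.2) ^ 2) ≤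
        u x - n / 2 * ((x.1 - y.1) ^ 2 + (x.2 - y.2) ^ 2)) :
    IsSuperdifferential O u x (n * (x.1 - y.1), n * (x.2 - y.2)) := by
  intro ε hε
  refine nhdsWithin_le_nhds ?_
  filter_upwards [hK, Metric.ball_mem_nhds x (div_pos hε hn)] with x' hx' hb
  have h1 := h x' hx'
  have h2 := sq_add_sq_le_norm_sq (x' - x)
  rw [Metric.mem_ball, dist_eq_norm, lt_div_iff₀ hn] at hb
  simp only [Prod.fst_sub, Prod.snd_sub] at h2
  have h3 : n * ‖x' - x‖ ^ 2 ≤ ε * ‖x' - x‖ := by nlinarith [norm_nonneg (x' - x)]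
  nlinarith

/-- At a maximum of the doubled function, the lower function, which here carries an additional
separable term, has the gradient of the penalty minus that of the term as a subgradient. -/
theorem isSubdifferential_of_doubling {O K : Set (ℝ × ℝ)} {v : ℝ × ℝ → ℝ} {g : ℝ → ℝ} {n : ℝ}
    (hn : 0 < n) {x y : ℝ × ℝ} {g₁ g₂ : ℝ} (hg₁ : HasDerivAt g g₁ y.1)
    (hg₂ : HasDerivAt g g₂ y.2) (hK : K ∈ 𝓝 y)
    (h : ∀ y' ∈ K, v y + (g y.1 + g y.2) + n / 2 * ((x.1 - y.1) ^ 2 + (x.2 - y.2) ^ 2) ≤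
        v y' + (g y'.1 + g y'.2) + n / 2 * ((x.1 - y'.1) ^ 2 + (x.2 - y'.2) ^ 2)) :
    IsSubdifferential O v y (n * (x.1 - y.1) - g₁, n * (x.2 - y.2) - g₂) := by
  intro ε hε
  refine nhdsWithin_le_nhds ?_
  have e1 := (continuous_fst.tendsto y).eventually
    (eventually_abs_sub_le_of_hasDerivAt hg₁ (show 0 < ε / 4 by linarith))
  have e2 := (continuous_snd.tendsto y).eventually
    (eventually_abs_sub_le_of_hasDerivAt hg₂ (show 0 < ε / 4 by linarith))
  filter_upwards [hK, Metric.ball_mem_nhds y (div_pos (half_pos hε) hn), e1, e2]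
    with y' hy' hb h3 h4
  have h1 := h y' hy'
  have h2 := sq_add_sq_le_norm_sq (y' - y)
  rw [Metric.mem_ball, dist_eq_norm, lt_div_iff₀ hn] at hb
  have a1 := norm_fst_le (y' - y)
  have a2 := norm_snd_le (y' - y)
  simp only [Prod.fst_sub, Prod.snd_sub, Real.norm_eq_abs] at h2 a1 a2
  have h5 : n * ‖y' - y‖ ^ 2 ≤ ε / 2 * ‖y' - y‖ := by nlinarith [norm_nonneg (y' - y)]
  have h6 := (abs_le.1 h3).2
  have h7 := (abs_le.1 h4).2
  have h8 : ε / 4 * |y'.1 - y.1| ≤ ε / 4 * ‖y' - y‖ := by gcongr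
  have h9 : ε / 4 * |y'.2 - y.2| ≤ ε / 4 * ‖y' - y‖ := by gcongr
  nlinarith

/-- Subgradients of functions that are non-decreasing in each variable are non-negative. -/
theorem IsSubdifferential.nonneg_of_monotoneOn {v : ℝ × ℝ → ℝ} (hv : MonotoneOn v openQuadrant)
    {x p : ℝ × ℝ} (hx : x ∈ openQuadrant) (hp : IsSubdifferential openQuadrant v x p) :
    0 ≤ p.1 ∧ 0 ≤ p.2 := by
  have key : ∀ e : ℝ × ℝ, 0 ≤ e → ‖e‖ ≤ 1 → 0 ≤ p.1 * e.1 + p.2 * e.2 := by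
    intro e he he1
    refine le_of_forall_pos_le_add fun ε hε => ?_
    have hO := isOpen_openQuadrant.mem_nhds hx
    have h1 := hp ε hε
    rw [nhdsWithin_eq_nhds.2 hO] at h1
    have hc : Tendsto (fun t : ℝ => x - t • e) (𝓝[>] 0) (𝓝 x) :=
      (Continuous.tendsto' (by fun_prop) _ _ (by simp)).mono_left nhdsWithin_le_nhds
    obtain ⟨t, ⟨h2, h3⟩, ht : 0 < t⟩ :=
      ((hc.eventually (h1.and hO)).and self_mem_nhdsWithin).exists
    have h4 : v (x - t • e) ≤ v x := hv h3 hx (sub_le_self _ (smul_nonneg ht.le he))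
    have h5 : ‖x - t • e - x‖ ≤ t := by
      rw [sub_sub_cancel_left, norm_neg, norm_smul, Real.norm_of_nonneg ht.le]
      exact mul_le_of_le_one_right ht.le he1
    simp only [Prod.fst_sub, Prod.snd_sub, Prod.smul_fst, Prod.smul_snd, smul_eq_mul] at h2
    have h6 : ε * ‖x - t • e - x‖ ≤ ε * t := by gcongr
    have h7 : 0 ≤ t * (p.1 * e.1 + p.2 * e.2 + ε) := by linarith
    exact nonneg_of_mul_nonneg_right h7 ht
  constructor
  · simpa using key (1, 0) ⟨by norm_num, by norm_num⟩ (by simp [Prod.norm_def])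
  · simpa using key (0, 1) ⟨by norm_num, by norm_num⟩ (by simp [Prod.norm_def])

/-- A subgradient of a monotone supersolution dominates the weight.  Where `σ = 0` the equation
gives no information; there `μ = 0`, and monotonicity takes over. -/
theorem weight_le_of_supersolution {m s p₁ p₂ : ℝ} (hs : s = 0 → m = 0) (h₁ : 0 ≤ p₁)
    (h₂ : 0 ≤ p₂) (h : 0 ≤ max (p₁ - m) 0 * max (p₂ - m) 0 - s ^ 2) :
    m ≤ p₁ ∧ m ≤ p₂ ∧ s ^ 2 ≤ (p₁ - m) * (p₂ - m) := by
  by_cases hs0 : s = 0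
  · rw [hs hs0, hs0]
    exact ⟨h₁, h₂, by simpa using mul_nonneg h₁ h₂⟩
  · have hpos : 0 < s ^ 2 := by positivity
    have a1 : 0 < p₁ - m := by
      by_contra! hc
      rw [max_eq_right hc] at h
      linarith
    have a2 : 0 < p₂ - m := by
      by_contra! hc
      rw [max_eq_right hc] at h
      linarith
    rw [max_eq_left a1.le, max_eq_left a2.le] at h
    exact ⟨by linarith, by linarith, by linarith⟩

/-- Lowering both factors of a product of positive numbers by `t`. -/
theorem mul_sub_le_max_mul_max {a b t : ℝ} (ha : 0 ≤ a) (hb : 0 ≤ b) (ht : 0 ≤ t) :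
    a * b - t * (a + b) ≤ max (a - t) 0 * max (b - t) 0 := by
  rcases le_total t a with h1 | h1
  · rcases le_total t b with h2 | h2
    · rw [max_eq_left (by linarith), max_eq_left (by linarith)]
      nlinarith [sq_nonneg t]
    · rw [max_eq_right (a := b - t) (by linarith)]
      nlinarith
  · rw [max_eq_right (a := a - t) (by linarith)]
    nlinarith

/-- The contradiction in the doubling argument, quantitatively: `p` satisfies the subsolution
inequality for the data `m, s`, and dominates by `ε` a vector `q` that satisfies the supersolution
inequality for the nearby data `m', s'`. -/
theorem sq_le_of_subsolution_of_supersolution {m m' s s' p₁ p₂ q₁ q₂ ε t e : ℝ} (hε : 0 ≤ ε)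
    (ht : 0 ≤ t) (hm' : 0 ≤ m') (hm : m ≤ m' + t) (hs : s ^ 2 ≤ s' ^ 2 + e)
    (hsub : max (p₁ - m) 0 * max (p₂ - m) 0 - s ^ 2 ≤ 0) (hq₁ : m' ≤ q₁) (hq₂ : m' ≤ q₂)
    (hq : s' ^ 2 ≤ (q₁ - m') * (q₂ - m')) (hp₁ : q₁ + ε ≤ p₁) (hp₂ : q₂ + ε ≤ p₂) :
    ε ^ 2 ≤ e + t * (p₁ + p₂) := by
  have h1 : (q₁ - m' + ε) * (q₂ - m' + ε) ≤ (p₁ - m') * (p₂ - m') :=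
    mul_le_mul (by linarith) (by linarith) (by linarith) (by linarith)
  have h2 := mul_nonneg hε (sub_nonneg.2 hq₁)
  have h3 := mul_nonneg hε (sub_nonneg.2 hq₂)
  have h4 := mul_sub_le_max_mul_max (a := p₁ - m') (b := p₂ - m') (t := t) (by linarith)
    (by linarith) ht
  have h5 : max (p₁ - m' - t) 0 * max (p₂ - m' - t) 0 ≤ max (p₁ - m) 0 * max (p₂ - m) 0 :=
    mul_le_mul (max_le_max (by linarith) le_rfl) (max_le_max (by linarith) le_rfl)
      (le_max_right _ _) (le_max_right _ _)
  have h6 := mul_nonneg ht hm'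
  linarith

theorem exists_abs_sub_le_of_lipschitzOnWith {f : ℝ × ℝ → ℝ} {s : Set (ℝ × ℝ)}
    (h : ∃ K : NNReal, LipschitzOnWith K f s) :
    ∃ L : ℝ, 0 ≤ L ∧ ∀ x ∈ s, ∀ y ∈ s, |f x - f y| ≤ L * (|x.1 - y.1| + |x.2 - y.2|) := by
  obtain ⟨K, hK⟩ := h
  refine ⟨K, K.2, fun x hx y hy => ?_⟩
  have := hK.dist_le_mul x hx y hy
  rw [Real.dist_eq, dist_eq_norm, Prod.norm_def] at this
  refine this.trans (mul_le_mul_of_nonneg_left ?_ K.2)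
  exact max_le (le_add_of_nonneg_right (abs_nonneg _)) (le_add_of_nonneg_left (abs_nonneg _))

/-- Comparison principle on the quadrant.  No growth condition is needed at infinity: information
only travels upwards, so a term increasing in `y` can be added to `v` to keep the maximum of the
doubled function away from the outer sides of a square, and it makes `v` a strict supersolution at
the same time. -/
theorem le_of_subsolution_of_supersolution {μ σ u v : ℝ × ℝ → ℝ}
    (hμ_nonneg : ∀ x ∈ closedQuadrant, 0 ≤ μ x)
    (hμ_lip : ∃ K : NNReal, LipschitzOnWith K μ closedQuadrant)
    (hσ_lip : ∃ K : NNReal, LipschitzOnWith K (fun x => σ x ^ 2) closedQuadrant)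
    (hzeros : ∀ x ∈ openQuadrant, σ x = 0 → μ x = 0)
    (hu : UpperSemicontinuousOn u closedQuadrant) (hv : LowerSemicontinuousOn v closedQuadrant)
    (hvmono : MonotoneOn v closedQuadrant)
    (hsub : ∀ x ∈ openQuadrant, ∀ p, IsSuperdifferential openQuadrant u x p →
      hamiltonian μ σ x p ≤ 0)
    (hsup : ∀ x ∈ openQuadrant, ∀ p, IsSubdifferential openQuadrant v x p →
      0 ≤ hamiltonian μ σ x p)
    (hbd : ∀ x ∈ quadrantBoundary, u x ≤ v x) :
    ∀ x ∈ closedQuadrant, u x ≤ v x := by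
  intro x₀ hx₀
  by_contra! hlt
  obtain ⟨L, hL0, hL⟩ := exists_abs_sub_le_of_lipschitzOnWith hμ_lip
  obtain ⟨S, hS0, hS⟩ := exists_abs_sub_le_of_lipschitzOnWith hσ_lip
  set r := x₀.1 + x₀.2 with hr
  have hr0 : 0 ≤ r := add_nonneg hx₀.1 hx₀.2
  set R := r + 1 with hR
  set K : Set (ℝ × ℝ) := Icc 0 R ×ˢ Icc 0 R with hKdef
  have hKc : IsCompact K := isCompact_Icc.prod isCompact_Icc
  have hKQ : K ⊆ closedQuadrant := fun x hx => ⟨hx.1.1, hx.2.1⟩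
  have hx₀K : x₀ ∈ K := ⟨⟨hx₀.1, by linarith [hx₀.2]⟩, ⟨hx₀.2, by linarith [hx₀.1]⟩⟩
  obtain ⟨xu, hxuK, hxu⟩ := (hu.mono hKQ).exists_isMaxOn ⟨x₀, hx₀K⟩ hKc
  set M := u xu - v 0 with hM
  have h0Q : (0 : ℝ × ℝ) ∈ closedQuadrant := ⟨le_rfl, le_rfl⟩
  have hv0 : ∀ x ∈ closedQuadrant, v 0 ≤ v x := fun x hx => hvmono h0Q hx ⟨hx.1, hx.2⟩
  -- `η` keeps `u - v - g` positive at `x₀`; `lam` makes `g` exceed `M` at distance `R`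
  set η := (u x₀ - v x₀) / 4 with hη
  have hη0 : 0 < η := by simp only [hη]; linarith
  have hM0 : 0 < M := by
    have h1 : u x₀ ≤ u xu := hxu hx₀K
    have h2 := hv0 x₀ hx₀
    simp only [hM]; linarith
  set lam := M / η with hlam
  have hlam0 : 0 < lam := div_pos hM0 hη0
  set g : ℝ → ℝ := fun t => η * Real.exp (lam * (t - r)) with hg
  have hgpos : ∀ t, 0 < g t := fun t => mul_pos hη0 (Real.exp_pos _)
  have hgder : ∀ t, HasDerivAt g (lam * g t) t := by
    intro t
    have h1 : HasDerivAt (fun t : ℝ => lam * (t - r)) lam t := by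
      simpa using ((hasDerivAt_id t).sub_const r).const_mul lam
    exact ((h1.exp).const_mul η).congr_deriv (by simp only [hg]; ring)
  have hgmono : Monotone g := fun a b hab => by simp only [hg]; gcongr
  have hgr : g r = η := by simp [hg]
  have hgR : M < g R := by
    have h1 := Real.add_one_le_exp (lam * (R - r))
    have h2 : lam * (R - r) = lam := by simp [hR]
    rw [h2] at h1
    simp only [hg, h2]
    have h3 : η * (lam + 1) = M + η := by rw [hlam]; field_simp
    nlinarith
  set ε := lam * g 0 with hε
  have hε0 : 0 < ε := mul_pos hlam0 (hgpos 0)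
  have hgc : Continuous g := continuous_iff_continuousAt.2 fun t => (hgder t).continuousAt
  obtain ⟨z, hzK, hzmax, hz⟩ := exists_doubling_point hKc (u := u)
    (w := fun y => v y + (g y.1 + g y.2)) (hu.mono hKQ)
    ((hv.mono hKQ).add (ContinuousOn.lowerSemicontinuousOn (by fun_prop))) ⟨x₀, hx₀K⟩
  have hzpos : 0 < u z - v z - g z.1 - g z.2 := by
    have h1 := hzmax x₀ hx₀K
    have h2 : g x₀.1 ≤ η := hgr ▸ hgmono (by linarith [hx₀.2])
    have h3 : g x₀.2 ≤ η := hgr ▸ hgmono (by linarith [hx₀.1])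
    linarith
  have hzQ := hKQ hzK
  have hzO : z ∈ openQuadrant := by
    by_contra hc
    have := hbd z (mem_quadrantBoundary_of_notMem hzQ hc)
    linarith [hgpos z.1, hgpos z.2]
  have hzM : g z.1 + g z.2 < M := by
    have h1 : u z ≤ u xu := hxu hzK
    have h2 := hv0 z hzQ
    simp only [hM]; linarith
  have hz1 : z.1 < R := by
    by_contra! hc
    linarith [hgmono hc, hgpos z.2]
  have hz2 : z.2 < R := by
    by_contra! hc
    linarith [hgmono hc, hgpos z.1]
  set N : Set (ℝ × ℝ) := Ioo 0 R ×ˢ Ioo 0 R with hN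
  have hNo : IsOpen N := isOpen_Ioo.prod isOpen_Ioo
  have hzN : z ∈ N := ⟨⟨hzO.1, hz1⟩, ⟨hzO.2, hz2⟩⟩
  have hNK : N ⊆ K := prod_mono Ioo_subset_Icc_self Ioo_subset_Icc_self
  have hNO : N ⊆ openQuadrant := fun x hx => ⟨hx.1.1, hx.2.1⟩
  obtain ⟨ρ, hρ0, hρ⟩ := Metric.isOpen_iff.1 hNo z hzN
  -- `c δ` bounds the error terms in the final estimate
  set c := 4 * S + 2 * L + 1 with hc
  have hc0 : 0 < c := by positivity
  set δ := min ρ (ε ^ 2 / c) with hδ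
  have hδ0 : 0 < δ := lt_min hρ0 (by positivity)
  obtain ⟨n, hn, x, hxK, y, hyK, hxz, hyz, hpen, hmax⟩ := hz δ hδ0
  have hxN : x ∈ N := hρ (by
    rw [Metric.mem_ball, dist_eq_norm]; exact hxz.trans_le (min_le_left _ _))
  have hyN : y ∈ N := hρ (by
    rw [Metric.mem_ball, dist_eq_norm]; exact hyz.trans_le (min_le_left _ _))
  have hP := hsub x (hNO hxN) _ (isSuperdifferential_of_doubling (y := y) hn
    (mem_of_superset (hNo.mem_nhds hxN) hNK) (fun x' hx' => by
      have := hmax x' hx' y hyK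
      linarith))
  have hD := isSubdifferential_of_doubling (O := openQuadrant) (v := v) (x := x) hn (hgder y.1)
    (hgder y.2) (mem_of_superset (hNo.mem_nhds hyN) hNK) (fun y' hy' => by
      have := hmax x hxK y' hy'
      linarith)
  have hD0 := hD.nonneg_of_monotoneOn (hvmono.mono openQuadrant_subset_closedQuadrant) (hNO hyN)
  obtain ⟨hq1, hq2, hq⟩ := weight_le_of_supersolution (hzeros y (hNO hyN)) hD0.1 hD0.2
    (hsup y (hNO hyN) _ hD)
  have hgy1 : ε ≤ lam * g y.1 := mul_le_mul_of_nonneg_left (hgmono hyN.1.1.le) hlam0.le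
  have hgy2 : ε ≤ lam * g y.2 := mul_le_mul_of_nonneg_left (hgmono hyN.2.1.le) hlam0.le
  set d := |x.1 - y.1| + |x.2 - y.2| with hd
  have hd0 : 0 ≤ d := by positivity
  have hkey := sq_le_of_subsolution_of_supersolution hε0.le (mul_nonneg hL0 hd0)
    (hμ_nonneg y (hKQ hyK))
    (sub_le_iff_le_add'.1 (abs_le.1 (hL x (hKQ hxK) y (hKQ hyK))).2)
    (sub_le_iff_le_add'.1 (abs_le.1 (hS x (hKQ hxK) y (hKQ hyK))).2)
    hP hq1 hq2 hq (by linarith) (by linarith)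
  rw [← hd] at hkey
  have hdd : d ^ 2 ≤ 2 * ((x.1 - y.1) ^ 2 + (x.2 - y.2) ^ 2) := by
    rw [← sq_abs (x.1 - y.1), ← sq_abs (x.2 - y.2), hd]
    linarith [sq_nonneg (|x.1 - y.1| - |x.2 - y.2|)]
  have hd4 : d < 4 * δ := by
    have e1 := norm_fst_le (x - z)
    have e2 := norm_snd_le (x - z)
    have e3 := norm_fst_le (y - z)
    have e4 := norm_snd_le (y - z)
    simp only [Prod.fst_sub, Prod.snd_sub, Real.norm_eq_abs] at e1 e2 e3 e4
    have f1 := abs_sub_le x.1 z.1 y.1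
    have f2 := abs_sub_le x.2 z.2 y.2
    rw [abs_sub_comm z.1] at f1
    rw [abs_sub_comm z.2] at f2
    linarith
  have hsum : n * (x.1 - y.1) + n * (x.2 - y.2) ≤ n * d := by
    rw [← mul_add]
    exact mul_le_mul_of_nonneg_left (add_le_add (le_abs_self _) (le_abs_self _)) hn.le
  have hfin1 : L * d * (n * (x.1 - y.1) + n * (x.2 - y.2)) ≤ 2 * L * δ := by
    calc L * d * (n * (x.1 - y.1) + n * (x.2 - y.2)) ≤ L * d * (n * d) := by gcongr
      _ = L * (n * d ^ 2) := by ring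
      _ ≤ L * (n * (2 * ((x.1 - y.1) ^ 2 + (x.2 - y.2) ^ 2))) := by gcongr
      _ = 2 * L * (n * ((x.1 - y.1) ^ 2 + (x.2 - y.2) ^ 2)) := by ring
      _ ≤ 2 * L * δ := by gcongr
  have hfin2 : S * d ≤ S * (4 * δ) := mul_le_mul_of_nonneg_left hd4.le hS0
  have hδc : δ * c ≤ ε ^ 2 := (le_div_iff₀ hc0).1 (min_le_right _ _)
  rw [hc] at hδc
  linarith

/-! ### Relaxed limits of a family of grid functions -/

/-- Neighbourhoods of `(0, x)` in `(0,∞) × [0,∞)²`: the grid spacing tends to zero while the point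
tends to `x`. -/
def relaxedFilter (x : ℝ × ℝ) : Filter (ℝ × (ℝ × ℝ)) :=
  𝓝[>] (0 : ℝ) ×ˢ 𝓝[closedQuadrant] x

/-- The upper relaxed limit `limsup_{h → 0+, y → x} f h y`.  The lower relaxed limit of `f` is
minus the upper relaxed limit of `-f`. -/
noncomputable def upperRelaxedLimit (f : ℝ → ℝ × ℝ → ℝ) (x : ℝ × ℝ) : ℝ :=
  limsup (fun p : ℝ × (ℝ × ℝ) => f p.1 p.2) (relaxedFilter x)

/-- The family is bounded near every point of the closed quadrant, uniformly for small spacing. -/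
def IsLocallyBoundedFamily (f : ℝ → ℝ × ℝ → ℝ) : Prop :=
  ∀ x ∈ closedQuadrant, ∃ C : ℝ, ∀ᶠ p in relaxedFilter x, |f p.1 p.2| ≤ C

theorem relaxedFilter_neBot {x : ℝ × ℝ} (hx : x ∈ closedQuadrant) : (relaxedFilter x).NeBot := by
  have : (𝓝[closedQuadrant] x).NeBot := mem_closure_iff_nhdsWithin_neBot.1 (subset_closure hx)
  exact Filter.prod_neBot.2 ⟨inferInstance, this⟩

theorem tendsto_fst_relaxedFilter (x : ℝ × ℝ) :
    Tendsto (fun p : ℝ × (ℝ × ℝ) => p.1) (relaxedFilter x) (𝓝[>] 0) := tendsto_fst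

theorem tendsto_snd_relaxedFilter (x : ℝ × ℝ) :
    Tendsto (fun p : ℝ × (ℝ × ℝ) => p.2) (relaxedFilter x) (𝓝[closedQuadrant] x) := tendsto_snd

theorem relaxedFilter_eq_nhdsWithin (x : ℝ × ℝ) :
    relaxedFilter x = 𝓝[Ioi 0 ×ˢ closedQuadrant] (0, x) := (nhdsWithin_prod_eq _ _ _ _).symm

namespace IsLocallyBoundedFamily

variable {f : ℝ → ℝ × ℝ → ℝ} {x : ℝ × ℝ} {c : ℝ}

theorem neg (hf : IsLocallyBoundedFamily f) : IsLocallyBoundedFamily (fun h y => -f h y) := by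
  simpa [IsLocallyBoundedFamily] using hf

theorem isBoundedUnder_le (hf : IsLocallyBoundedFamily f) (hx : x ∈ closedQuadrant) :
    IsBoundedUnder (· ≤ ·) (relaxedFilter x) (fun p => f p.1 p.2) := by
  obtain ⟨C, hC⟩ := hf x hx
  exact ⟨C, eventually_map.2 (hC.mono fun p hp => (abs_le.1 hp).2)⟩

theorem isCoboundedUnder_le (hf : IsLocallyBoundedFamily f) (hx : x ∈ closedQuadrant) :
    IsCoboundedUnder (· ≤ ·) (relaxedFilter x) (fun p => f p.1 p.2) := by
  have := relaxedFilter_neBot hx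
  obtain ⟨C, hC⟩ := hf x hx
  have hb : IsBoundedUnder (· ≥ ·) (relaxedFilter x) (fun p => f p.1 p.2) :=
    ⟨-C, eventually_map.2 (hC.mono fun p hp => (abs_le.1 hp).1)⟩
  exact hb.isCoboundedUnder_le

theorem eventually_lt (hf : IsLocallyBoundedFamily f) (hx : x ∈ closedQuadrant)
    (h : upperRelaxedLimit f x < c) : ∀ᶠ p in relaxedFilter x, f p.1 p.2 < c :=
  eventually_lt_of_limsup_lt h (hf.isBoundedUnder_le hx)

theorem frequently_lt (hf : IsLocallyBoundedFamily f) (hx : x ∈ closedQuadrant)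
    (h : c < upperRelaxedLimit f x) : ∃ᶠ p in relaxedFilter x, c < f p.1 p.2 :=
  frequently_lt_of_lt_limsup (hf.isCoboundedUnder_le hx) h

theorem upperRelaxedLimit_le (hf : IsLocallyBoundedFamily f) (hx : x ∈ closedQuadrant)
    (h : ∀ᶠ p in relaxedFilter x, f p.1 p.2 ≤ c) : upperRelaxedLimit f x ≤ c :=
  limsup_le_of_le (hf.isCoboundedUnder_le hx) h

/-- The lower relaxed limit is at most the upper one. -/
theorem neg_upperRelaxedLimit_neg_le (hf : IsLocallyBoundedFamily f) (hx : x ∈ closedQuadrant) :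
    -upperRelaxedLimit (fun h y => -f h y) x ≤ upperRelaxedLimit f x := by
  refine le_of_forall_pos_le_add fun ε hε => ?_
  have := relaxedFilter_neBot hx
  have h1 := hf.eventually_lt hx (lt_add_of_pos_right (upperRelaxedLimit f x) (half_pos hε))
  have h2 := hf.neg.eventually_lt hx
    (lt_add_of_pos_right (upperRelaxedLimit (fun h y => -f h y) x) (half_pos hε))
  obtain ⟨p, h3, h4⟩ := (h1.and h2).exists
  linarith

theorem upperSemicontinuousOn (hf : IsLocallyBoundedFamily f) :
    UpperSemicontinuousOn (upperRelaxedLimit f) closedQuadrant := by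
  intro x hx c hc
  obtain ⟨c', hc1, hc2⟩ := exists_between hc
  have h1 : ∀ᶠ p in 𝓝[>] (0 : ℝ) ×ˢ 𝓝[closedQuadrant] x, f p.1 p.2 < c' :=
    hf.eventually_lt hx hc1
  obtain ⟨P, hP, P', hP', h⟩ := eventually_prod_iff.1 h1
  filter_upwards [eventually_eventually_nhdsWithin.2 hP', self_mem_nhdsWithin] with y hy hyQ
  refine (hf.upperRelaxedLimit_le hyQ ?_).trans_lt hc2
  exact eventually_prod_iff.2 ⟨P, hP, P', hy, fun a _ b => (h a b).le⟩

end IsLocallyBoundedFamily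

/-- The lower relaxed limit of functions that are non-decreasing in each variable is
non-decreasing: as `y` tends to a larger point, `y ⊓ x` tends to `x`. -/
theorem monotoneOn_neg_upperRelaxedLimit_neg {f : ℝ → ℝ × ℝ → ℝ} (hf : IsLocallyBoundedFamily f)
    (hmono : ∀ h > 0, MonotoneOn (f h) closedQuadrant) :
    MonotoneOn (fun x => -upperRelaxedLimit (fun h y => -f h y) x) closedQuadrant := by
  intro x hx x' hx' hxx'
  refine neg_le_neg (le_of_forall_gt_imp_ge_of_dense fun c hc => ?_)
  refine hf.neg.upperRelaxedLimit_le hx' ?_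
  have hinf : Tendsto (fun p : ℝ × (ℝ × ℝ) => (p.1, p.2 ⊓ x)) (relaxedFilter x')
      (relaxedFilter x) := by
    refine (tendsto_fst_relaxedFilter x').prodMk (tendsto_nhdsWithin_iff.2 ⟨?_, ?_⟩)
    · have hc : Tendsto (fun y : ℝ × ℝ => y ⊓ x) (𝓝[closedQuadrant] x') (𝓝 x) :=
        ((continuous_fst.min continuous_const).prodMk
          (continuous_snd.min continuous_const)).tendsto' x' x (inf_eq_right.2 hxx')
          |>.mono_left nhdsWithin_le_nhds
      exact hc.comp (tendsto_snd_relaxedFilter x')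
    · filter_upwards [(tendsto_snd_relaxedFilter x').eventually self_mem_nhdsWithin] with p hp
      exact ⟨le_min hp.1 hx.1, le_min hp.2 hx.2⟩
  filter_upwards [hinf.eventually (hf.neg.eventually_lt hx hc),
    hinf.eventually ((tendsto_snd_relaxedFilter x).eventually self_mem_nhdsWithin),
    (tendsto_snd_relaxedFilter x').eventually self_mem_nhdsWithin,
    (tendsto_fst_relaxedFilter x').eventually self_mem_nhdsWithin] with p h1 h2 h3 h4
  have := hmono p.1 h4 h2 h3 inf_le_left
  linarith

/-- The point `(hi, hj)` of the grid with spacing `h`. -/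
def gridPoint (h : ℝ) (i j : ℕ) : ℝ × ℝ := (h * i, h * j)

theorem finite_gridPoint_mem_closedBall {h : ℝ} (hh : 0 < h) (x : ℝ × ℝ) (r : ℝ) :
    {k : ℕ × ℕ | gridPoint h k.1 k.2 ∈ Metric.closedBall x r}.Finite := by
  refine ((finite_Iic ⌊(‖x‖ + r) / h⌋₊).prod (finite_Iic ⌊(‖x‖ + r) / h⌋₊)).subset ?_
  rintro ⟨i, j⟩ hk
  have hk' : ‖gridPoint h i j - x‖ ≤ r := by simpa [dist_eq_norm] using hk
  have h1 := norm_fst_le (gridPoint h i j)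
  have h2 := norm_snd_le (gridPoint h i j)
  have h3 := norm_le_norm_add_norm_sub' (gridPoint h i j) x
  simp only [gridPoint, Real.norm_eq_abs] at h1 h2 h3 hk'
  have h4 := le_abs_self (h * (i : ℝ))
  have h5 := le_abs_self (h * (j : ℝ))
  exact ⟨Nat.le_floor (by rw [le_div_iff₀ hh]; linarith),
    Nat.le_floor (by rw [le_div_iff₀ hh]; linarith)⟩

theorem norm_gridPoint_floor_sub_le {h : ℝ} (hh : 0 < h) {y : ℝ × ℝ} (hy : y ∈ closedQuadrant) :
    ‖gridPoint h ⌊h⁻¹ * y.1⌋₊ ⌊h⁻¹ * y.2⌋₊ - y‖ ≤ h := by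
  have key : ∀ t : ℝ, 0 ≤ t → |h * (⌊h⁻¹ * t⌋₊ : ℝ) - t| ≤ h := by
    intro t ht
    have h1 := Nat.floor_le (show 0 ≤ h⁻¹ * t by positivity)
    have h2 := Nat.lt_floor_add_one (h⁻¹ * t)
    have h3 : h * (h⁻¹ * t) = t := by field_simp
    rw [abs_le]
    constructor <;> nlinarith
  rw [Prod.norm_def]
  exact max_le (key _ hy.1) (key _ hy.2)

/-- If `p` is a supergradient of the upper relaxed limit at `x`, then at grid points arbitrarily
close to `x`, for arbitrarily small spacing, the backward differences of `f` are at least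
`h (p - 2ε)`: such a point is found by maximizing `f h y - p · (y - x) - 2 ε ‖y - x‖` over the
grid points of a ball.  No smooth test function is needed, since the norm is Lipschitz. -/
theorem exists_gridPoint_backward_difference_ge {f : ℝ → ℝ × ℝ → ℝ}
    (hf : IsLocallyBoundedFamily f)
    (hgrid : ∀ h > 0, ∀ y ∈ closedQuadrant,
      f h y = f h (gridPoint h ⌊h⁻¹ * y.1⌋₊ ⌊h⁻¹ * y.2⌋₊))
    {x p : ℝ × ℝ} (hx : x ∈ openQuadrant)
    (hp : IsSuperdifferential openQuadrant (upperRelaxedLimit f) x p)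
    {ε ρ : ℝ} (hε : 0 < ε) (hρ : 0 < ρ) :
    ∃ h : ℝ, 0 < h ∧ ∃ i j : ℕ, ‖gridPoint h (i + 1) (j + 1) - x‖ < ρ ∧
      h * (p.1 - 2 * ε) ≤ f h (gridPoint h (i + 1) (j + 1)) - f h (gridPoint h i (j + 1)) ∧
      h * (p.2 - 2 * ε) ≤ f h (gridPoint h (i + 1) (j + 1)) - f h (gridPoint h (i + 1) j) := by
  have hO := isOpen_openQuadrant.mem_nhds hx
  have hxQ := openQuadrant_subset_closedQuadrant hx
  have h1 := hp ε hε
  rw [nhdsWithin_eq_nhds.2 hO] at h1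
  obtain ⟨r, hr0, hr⟩ := Metric.nhds_basis_closedBall.mem_iff.1 (h1.and hO)
  set u := upperRelaxedLimit f with hu
  set ψ : ℝ × ℝ → ℝ := fun y => p.1 * (y.1 - x.1) + p.2 * (y.2 - x.2) + 2 * ε * ‖y - x‖ with hψ
  have hψc : Continuous ψ := by fun_prop
  have hψx : ψ x = 0 := by simp [hψ]
  set δ := min ρ (r / 2) with hδ
  have hδ0 : 0 < δ := lt_min hρ (by linarith)
  set A := Metric.closedBall x r ∩ {y | δ ≤ ‖y - x‖} with hA
  have hAc : IsCompact A := (isCompact_closedBall x r).inter_right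
    (isClosed_le continuous_const (by fun_prop))
  have hεδ : 0 < ε * δ := mul_pos hε hδ0
  -- away from `x` the maximum is not attained
  have hfar : ∀ᶠ h in 𝓝 (0 : ℝ), ∀ y ∈ A, 0 < h → f h y - ψ y < u x - ε * δ / 2 := by
    refine hAc.eventually_forall_of_forall_eventually fun y hy => ?_
    have hyr := hr hy.1
    have hyQ : closedQuadrant ∈ 𝓝 y :=
      mem_of_superset (isOpen_openQuadrant.mem_nhds hyr.2) openQuadrant_subset_closedQuadrant
    have huy : u y + ε * δ ≤ u x + ψ y := by
      have h3 := hyr.1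
      have h4 : ε * δ ≤ ε * ‖y - x‖ := mul_le_mul_of_nonneg_left hy.2 hε.le
      simp only [hψ]
      linarith
    have e1 := hf.eventually_lt (openQuadrant_subset_closedQuadrant hyr.2)
      (lt_add_of_pos_right (u y) (show 0 < ε * δ / 4 by linarith))
    rw [relaxedFilter_eq_nhdsWithin, eventually_nhdsWithin_iff] at e1
    have e2 : ∀ᶠ z : ℝ × (ℝ × ℝ) in 𝓝 (0, y), ψ y - ε * δ / 4 < ψ z.2 :=
      ((hψc.comp continuous_snd).tendsto (0, y)).eventually
        (lt_mem_nhds (show ψ y - ε * δ / 4 < ψ y by linarith))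
    have e3 : ∀ᶠ z : ℝ × (ℝ × ℝ) in 𝓝 (0, y), z.2 ∈ closedQuadrant :=
      (continuous_snd.tendsto ((0 : ℝ), y)).eventually hyQ
    filter_upwards [e1, e2, e3] with z hz1 hz2 hz3 hz4
    have := hz1 ⟨hz4, hz3⟩
    linarith
  -- near `x` the value `u x` is almost attained at grid points
  obtain ⟨s, hs0, hs⟩ := Metric.nhds_basis_ball.mem_iff.1
    ((hψc.tendsto x).eventually (gt_mem_nhds (show ψ x < ε * δ / 8 by linarith)))
  set t := min (s / 2) (r / 2) with ht
  have ht0 : 0 < t := lt_min (by linarith) (by linarith)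
  have hnear := hf.frequently_lt hxQ (show u x - ε * δ / 8 < u x by linarith)
  have ev1 := (tendsto_fst_relaxedFilter x).eventually
    ((hfar.filter_mono nhdsWithin_le_nhds).and (self_mem_nhdsWithin (s := Ioi (0 : ℝ))))
  have ev2 := (tendsto_fst_relaxedFilter x).eventually
    ((gt_mem_nhds ht0).filter_mono nhdsWithin_le_nhds)
  have ev3 := (tendsto_snd_relaxedFilter x).eventually
    (inter_mem_nhdsWithin closedQuadrant (Metric.ball_mem_nhds x ht0))
  obtain ⟨⟨h, y⟩, hlt, ⟨hfar', hh⟩, hht, hyQ, hyt⟩ :=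
    (hnear.and_eventually (ev1.and (ev2.and ev3))).exists
  simp only at hlt hfar' hh hht hyQ hyt
  have hst : t ≤ s / 2 := min_le_left _ _
  have hrt : t ≤ r / 2 := min_le_right _ _
  have hz0 := norm_gridPoint_floor_sub_le hh hyQ
  rw [hgrid h hh y hyQ] at hlt
  set i₀ := ⌊h⁻¹ * y.1⌋₊
  set j₀ := ⌊h⁻¹ * y.2⌋₊
  rw [Metric.mem_ball, dist_eq_norm] at hyt
  have hz0x : ‖gridPoint h i₀ j₀ - x‖ < 2 * t := by
    have := norm_sub_le_norm_sub_add_norm_sub (gridPoint h i₀ j₀) y x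
    linarith
  have hψ0 : ψ (gridPoint h i₀ j₀) < ε * δ / 8 :=
    hs (by rw [Metric.mem_ball, dist_eq_norm]; linarith)
  obtain ⟨⟨i, j⟩, hmem, hmax⟩ := exists_max_image _
    (fun k : ℕ × ℕ => f h (gridPoint h k.1 k.2) - ψ (gridPoint h k.1 k.2))
    (finite_gridPoint_mem_closedBall hh x r)
    ⟨(i₀, j₀), by
      show gridPoint h i₀ j₀ ∈ Metric.closedBall x r
      rw [Metric.mem_closedBall, dist_eq_norm]; linarith⟩
  have hmem' : gridPoint h i j ∈ Metric.closedBall x r := hmem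
  have hmax' : ∀ i' j' : ℕ, ‖gridPoint h i' j' - x‖ ≤ r →
      f h (gridPoint h i' j') - ψ (gridPoint h i' j') ≤
        f h (gridPoint h i j) - ψ (gridPoint h i j) := by
    intro i' j' hij
    refine hmax (i', j') ?_
    show gridPoint h i' j' ∈ Metric.closedBall x r
    rwa [Metric.mem_closedBall, dist_eq_norm]
  have hclose : ‖gridPoint h i j - x‖ < δ := by
    by_contra! hc
    have h5 := hfar' (gridPoint h i j) ⟨hmem', hc⟩ hh
    have h6 := hmax' i₀ j₀ (by linarith)
    linarith
  have hpos := (hr hmem').2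
  have hi : i ≠ 0 := by
    rintro rfl
    simpa [gridPoint] using hpos.1
  have hj : j ≠ 0 := by
    rintro rfl
    simpa [gridPoint] using hpos.2
  obtain ⟨i, rfl⟩ := Nat.exists_eq_succ_of_ne_zero hi
  obtain ⟨j, rfl⟩ := Nat.exists_eq_succ_of_ne_zero hj
  have hδr : δ ≤ r / 2 := min_le_right _ _
  have hstep1 : ‖gridPoint h i (j + 1) - gridPoint h (i + 1) (j + 1)‖ = h := by
    simp [gridPoint, Prod.norm_def, mul_add, abs_of_pos hh, hh.le]
  have hstep2 : ‖gridPoint h (i + 1) j - gridPoint h (i + 1) (j + 1)‖ = h := by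
    simp [gridPoint, Prod.norm_def, mul_add, abs_of_pos hh, hh.le]
  have n1 := norm_sub_le_norm_sub_add_norm_sub (gridPoint h i (j + 1))
    (gridPoint h (i + 1) (j + 1)) x
  have n2 := norm_sub_le_norm_sub_add_norm_sub (gridPoint h (i + 1) j)
    (gridPoint h (i + 1) (j + 1)) x
  refine ⟨h, hh, i, j, hclose.trans_le (min_le_left _ _), ?_, ?_⟩
  · have h7 := hmax' i (j + 1) (by linarith)
    have h8 : ε * ‖gridPoint h i (j + 1) - x‖ ≤
      ε * (h + ‖gridPoint h (i + 1) (j + 1) - x‖) := by gcongr; linarith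
    simp only [hψ] at h7
    simp only [gridPoint, Nat.cast_add, Nat.cast_one, Nat.succ_eq_add_one] at h7 h8 ⊢
    linarith
  · have h7 := hmax' (i + 1) j (by linarith)
    have h8 : ε * ‖gridPoint h (i + 1) j - x‖ ≤
      ε * (h + ‖gridPoint h (i + 1) (j + 1) - x‖) := by gcongr; linarith
    simp only [hψ] at h7
    simp only [gridPoint, Nat.cast_add, Nat.cast_one, Nat.succ_eq_add_one] at h7 h8 ⊢
    linarith

/-! ### Monotonicity of the scheme and discrete barriers -/

theorem add_mul_le_schemeUpdate {h m v a b : ℝ} (hv : 0 ≤ v) :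
    a + h * m ≤ schemeUpdate h m v a b ∧ b + h * m ≤ schemeUpdate h m v a b := by
  have h1 : |a - b| ≤ Real.sqrt ((a - b) ^ 2 + 4 * h ^ 2 * v) :=
    Real.abs_le_sqrt (le_add_of_nonneg_right (by positivity))
  have h2 := abs_le.1 h1
  unfold schemeUpdate
  constructor <;> linarith

/-- The update formula picks the larger root of a quadratic equation, the discrete form of
`(U_{x₁} - μ)₊ (U_{x₂} - μ)₊ = σ²`. -/
theorem schemeUpdate_sub_mul_sub {h m v : ℝ} (hv : 0 ≤ v) (a b : ℝ) :
    (schemeUpdate h m v a b - a - h * m) * (schemeUpdate h m v a b - b - h * m) = h ^ 2 * v := by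
  have h1 : Real.sqrt ((a - b) ^ 2 + 4 * h ^ 2 * v) ^ 2 = (a - b) ^ 2 + 4 * h ^ 2 * v :=
    Real.sq_sqrt (by positivity)
  unfold schemeUpdate
  linear_combination (1 / 4) * h1

/-- Criterion for a discrete supersolution: `d` and `e` bound from below what the increments of `c`
over `a` and `b` leave after the weight. -/
theorem schemeUpdate_le {h m v a b c d e : ℝ} (hv : 0 ≤ v) (hd : 0 ≤ d) (he : 0 ≤ e)
    (ha : a + h * m + d ≤ c) (hb : b + h * m + e ≤ c) (hde : h ^ 2 * v ≤ d * e) :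
    schemeUpdate h m v a b ≤ c := by
  obtain ⟨h1, h2⟩ := add_mul_le_schemeUpdate (h := h) (m := m) (a := a) (b := b) hv
  have h3 := schemeUpdate_sub_mul_sub (h := h) (m := m) hv a b
  by_contra! hlt
  have h4 : d * e ≤ (c - a - h * m) * (c - b - h * m) :=
    mul_le_mul (by linarith) (by linarith) he (by linarith)
  have h5 : (c - a - h * m) * (c - b - h * m) <
      (schemeUpdate h m v a b - a - h * m) * (schemeUpdate h m v a b - b - h * m) := by
    rcases le_total a b with hab | hab
    · have : 0 ≤ c - b - h * m := by linarith
      nlinarith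
    · have : 0 ≤ c - a - h * m := by linarith
      nlinarith
  linarith

section Scheme

variable {μ μs σ : ℝ × ℝ → ℝ} {h : ℝ}

theorem schemeValue_zero_zero : schemeValue μ μs σ h 0 0 =
    schemeUpdate h (totalWeight μ μs (gridPoint h 0 0)) (σ (gridPoint h 0 0) ^ 2) 0 0 := by
  simp [schemeValue, gridPoint]

theorem schemeValue_zero_succ (j : ℕ) : schemeValue μ μs σ h 0 (j + 1) =
    schemeUpdate h (totalWeight μ μs (gridPoint h 0 (j + 1))) (σ (gridPoint h 0 (j + 1)) ^ 2) 0
      (schemeValue μ μs σ h 0 j) := by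
  simp [schemeValue, gridPoint]

theorem schemeValue_succ_zero (i : ℕ) : schemeValue μ μs σ h (i + 1) 0 =
    schemeUpdate h (totalWeight μ μs (gridPoint h (i + 1) 0)) (σ (gridPoint h (i + 1) 0) ^ 2)
      (schemeValue μ μs σ h i 0) 0 := by
  simp [schemeValue, gridPoint]

theorem schemeValue_succ_succ (i j : ℕ) : schemeValue μ μs σ h (i + 1) (j + 1) =
    schemeUpdate h (totalWeight μ μs (gridPoint h (i + 1) (j + 1)))
      (σ (gridPoint h (i + 1) (j + 1)) ^ 2) (schemeValue μ μs σ h i (j + 1))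
      (schemeValue μ μs σ h (i + 1) j) := by
  simp [schemeValue, gridPoint]

theorem schemeValue_add_le_left (i j : ℕ) : schemeValue μ μs σ h i j +
    h * totalWeight μ μs (gridPoint h (i + 1) j) ≤ schemeValue μ μs σ h (i + 1) j := by
  cases j with
  | zero => rw [schemeValue_succ_zero]; exact (add_mul_le_schemeUpdate (sq_nonneg _)).1
  | succ j => rw [schemeValue_succ_succ]; exact (add_mul_le_schemeUpdate (sq_nonneg _)).1

theorem schemeValue_add_le_right (i j : ℕ) : schemeValue μ μs σ h i j +
    h * totalWeight μ μs (gridPoint h i (j + 1)) ≤ schemeValue μ μs σ h i (j + 1) := by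
  cases i with
  | zero => rw [schemeValue_zero_succ]; exact (add_mul_le_schemeUpdate (sq_nonneg _)).2
  | succ i => rw [schemeValue_succ_succ]; exact (add_mul_le_schemeUpdate (sq_nonneg _)).2

theorem gridPoint_mem_closedQuadrant (hh : 0 ≤ h) (i j : ℕ) : gridPoint h i j ∈ closedQuadrant :=
  ⟨by simp only [gridPoint]; positivity, by simp only [gridPoint]; positivity⟩

theorem schemeValue_mono (hw : ∀ x ∈ closedQuadrant, 0 ≤ totalWeight μ μs x) (hh : 0 ≤ h)
    {i i' j j' : ℕ} (hi : i ≤ i') (hj : j ≤ j') :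
    schemeValue μ μs σ h i j ≤ schemeValue μ μs σ h i' j' := by
  have h1 : Monotone fun i => schemeValue μ μs σ h i j := monotone_nat_of_le_succ fun k => by
    linarith [schemeValue_add_le_left (μ := μ) (μs := μs) (σ := σ) (h := h) k j,
      mul_nonneg hh (hw _ (gridPoint_mem_closedQuadrant hh (k + 1) j))]
  have h2 : Monotone fun j => schemeValue μ μs σ h i' j := monotone_nat_of_le_succ fun k => by
    linarith [schemeValue_add_le_right (μ := μ) (μs := μs) (σ := σ) (h := h) i' k,
      mul_nonneg hh (hw _ (gridPoint_mem_closedQuadrant hh i' (k + 1)))]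
  exact (h1 hi).trans (h2 hj)

/-- Along the axes the scheme accumulates at least the weights it meets. -/
theorem sum_weight_le_schemeValue_left (i : ℕ) :
    ∑ k ∈ Finset.range (i + 1), h * totalWeight μ μs (gridPoint h k 0) ≤
      schemeValue μ μs σ h i 0 := by
  induction i with
  | zero =>
    have := (add_mul_le_schemeUpdate (h := h) (m := totalWeight μ μs (gridPoint h 0 0)) (a := 0)
      (b := 0) (sq_nonneg (σ (gridPoint h 0 0)))).1
    rw [schemeValue_zero_zero]
    simpa using this
  | succ i ih =>
    rw [Finset.sum_range_succ]
    linarith [schemeValue_add_le_left (μ := μ) (μs := μs) (σ := σ) (h := h) i 0]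

theorem sum_weight_le_schemeValue_right (j : ℕ) :
    ∑ k ∈ Finset.range (j + 1), h * totalWeight μ μs (gridPoint h 0 k) ≤
      schemeValue μ μs σ h 0 j := by
  induction j with
  | zero =>
    have := (add_mul_le_schemeUpdate (h := h) (m := totalWeight μ μs (gridPoint h 0 0)) (a := 0)
      (b := 0) (sq_nonneg (σ (gridPoint h 0 0)))).1
    rw [schemeValue_zero_zero]
    simpa using this
  | succ j ih =>
    rw [Finset.sum_range_succ]
    linarith [schemeValue_add_le_right (μ := μ) (μs := μs) (σ := σ) (h := h) 0 j]

/-- A supersolution of the scheme: the weights along both axes, a term that absorbs the growth of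
the weight into the quadrant, and the grid form of `2 s √(x₁ x₂)`, which solves the equation with
`μ = 0` and `σ = s`. -/
noncomputable def schemeBarrier (w : ℝ × ℝ → ℝ) (L s h : ℝ) (i j : ℕ) : ℝ :=
  ∑ k ∈ Finset.range (i + 1), h * w (gridPoint h k 0) +
    ∑ k ∈ Finset.range (j + 1), h * w (gridPoint h 0 k) +
    L * (h * ((i : ℝ) + 1)) * (h * ((j : ℝ) + 1)) +
    2 * s * h * (√((i : ℝ) + 1) * √((j : ℝ) + 1))

theorem half_le_sqrt_succ_mul_sub (n : ℕ) :
    1 / 2 ≤ √((n : ℝ) + 1) * (√((n : ℝ) + 1) - √(n : ℝ)) := by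
  have h1 := Real.sq_sqrt (show 0 ≤ (n : ℝ) + 1 by positivity)
  have h2 := Real.sq_sqrt (show 0 ≤ (n : ℝ) by positivity)
  linarith [sq_nonneg (√((n : ℝ) + 1) - √(n : ℝ))]

theorem schemeValue_le_schemeBarrier (hw : ∀ x ∈ closedQuadrant, 0 ≤ totalWeight μ μs x)
    (hh : 0 ≤ h) {L s R : ℝ} (hL0 : 0 ≤ L) (hs0 : 0 ≤ s)
    (hL : ∀ x ∈ openQuadrant, totalWeight μ μs x ≤ totalWeight μ μs (x.1, 0) + L * x.2 ∧
      totalWeight μ μs x ≤ totalWeight μ μs (0, x.2) + L * x.1)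
    (hs : ∀ x ∈ closedQuadrant, x.1 ≤ R → x.2 ≤ R → σ x ^ 2 ≤ s ^ 2) (i j : ℕ)
    (hi : h * i ≤ R) (hj : h * j ≤ R) :
    schemeValue μ μs σ h i j ≤ schemeBarrier (totalWeight μ μs) L s h i j := by
  have hdrift : ∀ i j : ℕ,
      h * totalWeight μ μs (gridPoint h (i + 1) (j + 1)) ≤
        h * totalWeight μ μs (gridPoint h (i + 1) 0) + L * h * (h * ((j : ℝ) + 1)) ∧
      h * totalWeight μ μs (gridPoint h (i + 1) (j + 1)) ≤
        h * totalWeight μ μs (gridPoint h 0 (j + 1)) + L * h * (h * ((i : ℝ) + 1)) := by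
    intro i j
    rcases hh.eq_or_lt with rfl | hpos
    · simp
    have := hL (gridPoint h (i + 1) (j + 1)) ⟨by simp only [gridPoint]; positivity,
      by simp only [gridPoint]; positivity⟩
    simp only [gridPoint, Nat.cast_zero, mul_zero, Nat.cast_add, Nat.cast_one] at this ⊢
    constructor <;> nlinarith
  -- the increments of the square root part multiply to at least `h² s²`
  have hprod : ∀ i j : ℕ, h * i ≤ R → h * j ≤ R → h ^ 2 * σ (gridPoint h i j) ^ 2 ≤
      2 * s * h * ((√((i : ℝ) + 1) - √(i : ℝ)) * √((j : ℝ) + 1)) *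
        (2 * s * h * (√((i : ℝ) + 1) * (√((j : ℝ) + 1) - √(j : ℝ)))) := by
    intro i j hi hj
    have h1 := hs _ (gridPoint_mem_closedQuadrant hh i j) hi hj
    have h2 := mul_le_mul (half_le_sqrt_succ_mul_sub i) (half_le_sqrt_succ_mul_sub j)
      (by norm_num) (le_trans (by norm_num) (half_le_sqrt_succ_mul_sub i))
    calc h ^ 2 * σ (gridPoint h i j) ^ 2 ≤ h ^ 2 * s ^ 2 := by gcongr
      _ = (4 * s ^ 2 * h ^ 2) * (1 / 2 * (1 / 2)) := by ring
      _ ≤ (4 * s ^ 2 * h ^ 2) * (√((i : ℝ) + 1) * (√((i : ℝ) + 1) - √(i : ℝ)) *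
          (√((j : ℝ) + 1) * (√((j : ℝ) + 1) - √(j : ℝ)))) := by gcongr
      _ = _ := by ring
  have hmono : ∀ n : ℕ, 0 ≤ √((n : ℝ) + 1) - √(n : ℝ) := fun n =>
    sub_nonneg.2 (Real.sqrt_le_sqrt (by linarith))
  have hd : ∀ i j : ℕ, 0 ≤ 2 * s * h * ((√((i : ℝ) + 1) - √(i : ℝ)) * √((j : ℝ) + 1)) :=
    fun i j => mul_nonneg (by positivity) (mul_nonneg (hmono i) (Real.sqrt_nonneg _))
  have he : ∀ i j : ℕ, 0 ≤ 2 * s * h * (√((i : ℝ) + 1) * (√((j : ℝ) + 1) - √(j : ℝ))) :=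
    fun i j => mul_nonneg (by positivity) (mul_nonneg (Real.sqrt_nonneg _) (hmono j))
  have hsum1 : ∀ i : ℕ, 0 ≤ ∑ k ∈ Finset.range i, h * totalWeight μ μs (gridPoint h k 0) :=
    fun i => Finset.sum_nonneg fun k _ =>
      mul_nonneg hh (hw _ (gridPoint_mem_closedQuadrant hh k 0))
  have hsum2 : ∀ j : ℕ, 0 ≤ ∑ k ∈ Finset.range j, h * totalWeight μ μs (gridPoint h 0 k) :=
    fun j => Finset.sum_nonneg fun k _ =>
      mul_nonneg hh (hw _ (gridPoint_mem_closedQuadrant hh 0 k))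
  have hLp : ∀ i j : ℕ, 0 ≤ L * (h * ((i : ℝ) + 1)) * (h * ((j : ℝ) + 1)) :=
    fun i j => by positivity
  have hLh : 0 ≤ L * h * h := by positivity
  induction i generalizing j with
  | zero =>
    induction j with
    | zero =>
      rw [schemeValue_zero_zero]
      refine schemeUpdate_le (sq_nonneg _) (hd 0 0) (he 0 0) ?_ ?_ (hprod 0 0 hi hj)
      all_goals
        simp [schemeBarrier]
        linarith [hw _ (gridPoint_mem_closedQuadrant hh 0 0),
          mul_nonneg hh (hw _ (gridPoint_mem_closedQuadrant hh 0 0))]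
    | succ j ih =>
      have hj' : h * (j : ℝ) ≤ R := by push_cast at hj; linarith
      have ih := ih hj'
      -- the left neighbour is off the grid; the sum along the other axis supplies the weight
      have hS := hsum2 (j + 1)
      have hS1 := hsum1 1
      rw [schemeValue_zero_succ]
      refine schemeUpdate_le (sq_nonneg _) (hd 0 (j + 1)) (he 0 (j + 1)) ?_ ?_
        (hprod 0 (j + 1) hi hj)
      · have hL' := hLp 0 (j + 1)
        rw [schemeBarrier, Finset.sum_range_succ _ (j + 1)]
        simp only [Nat.cast_zero, Real.sqrt_zero, sub_zero] at hL' ⊢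
        linarith
      · rw [schemeBarrier] at ih ⊢
        rw [Finset.sum_range_succ _ (j + 1)]
        simp only [Nat.cast_zero, Nat.cast_add, Nat.cast_one] at ih ⊢
        linarith
  | succ i ihi =>
    have hi' : h * (i : ℝ) ≤ R := by push_cast at hi; linarith
    induction j with
    | zero =>
      have ih := ihi 0 hi' hj
      have hS := hsum1 (i + 1)
      have hS1 := hsum2 1
      rw [schemeValue_succ_zero]
      refine schemeUpdate_le (sq_nonneg _) (hd (i + 1) 0) (he (i + 1) 0) ?_ ?_
        (hprod (i + 1) 0 hi hj)
      · rw [schemeBarrier] at ih ⊢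
        rw [Finset.sum_range_succ _ (i + 1)]
        simp only [Nat.cast_zero, Nat.cast_add, Nat.cast_one] at ih ⊢
        linarith
      · have hL' := hLp (i + 1) 0
        rw [schemeBarrier, Finset.sum_range_succ _ (i + 1)]
        simp only [Nat.cast_zero, Real.sqrt_zero, sub_zero] at hL' ⊢
        linarith
    | succ j ihj =>
      have hj' : h * (j : ℝ) ≤ R := by push_cast at hj; linarith
      have ih1 := ihi (j + 1) hi' hj
      have ih2 := ihj hj'
      obtain ⟨hd1, hd2⟩ := hdrift i j
      rw [schemeValue_succ_succ]
      refine schemeUpdate_le (sq_nonneg _) (hd (i + 1) (j + 1)) (he (i + 1) (j + 1)) ?_ ?_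
        (hprod (i + 1) (j + 1) hi hj)
      · rw [schemeBarrier] at ih1 ⊢
        rw [Finset.sum_range_succ _ (i + 1)]
        simp only [Nat.cast_add, Nat.cast_one] at ih1 ⊢
        linarith
      · rw [schemeBarrier] at ih2 ⊢
        rw [Finset.sum_range_succ _ (j + 1)]
        simp only [Nat.cast_add, Nat.cast_one] at ih2 ⊢
        linarith

end Scheme

/-! ### Riemann sums along the axes -/

section RiemannSum

variable {ι : Type*} {l : Filter ι} {H S : ι → ℝ} {s₀ : ℝ} {g : ℝ → ℝ}

theorem abs_mul_floor_add_one_sub_le {h s : ℝ} (hh : 0 < h) (hs : 0 ≤ s) :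
    |h * ((⌊h⁻¹ * s⌋₊ : ℝ) + 1) - s| ≤ h := by
  have h1 := Nat.floor_le (show 0 ≤ h⁻¹ * s by positivity)
  have h2 := Nat.lt_floor_add_one (h⁻¹ * s)
  have h3 : h * (h⁻¹ * s) = s := by field_simp
  rw [abs_le]
  constructor <;> nlinarith

theorem tendsto_mul_floor_add_one (hH : Tendsto H l (𝓝[>] 0)) (hS : Tendsto S l (𝓝 s₀))
    (hS0 : ∀ᶠ k in l, 0 ≤ S k) :
    Tendsto (fun k => H k * ((⌊(H k)⁻¹ * S k⌋₊ : ℝ) + 1)) l (𝓝 s₀) := by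
  have h1 : Tendsto (fun k => H k * ((⌊(H k)⁻¹ * S k⌋₊ : ℝ) + 1) - S k) l (𝓝 0) := by
    refine squeeze_zero_norm' ?_ (hH.mono_right nhdsWithin_le_nhds)
    filter_upwards [hH.eventually self_mem_nhdsWithin, hS0] with k hk hk0
    exact abs_mul_floor_add_one_sub_le hk hk0
  simpa using h1.add hS

theorem tendsto_mul_floor (t : ℝ) (ht : 0 ≤ t) :
    Tendsto (fun h : ℝ => h * (⌊h⁻¹ * t⌋₊ : ℝ)) (𝓝[>] 0) (𝓝 t) := by
  have h1 := tendsto_mul_floor_add_one (l := 𝓝[>] (0 : ℝ)) (H := id) (S := fun _ => t) tendsto_id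
    tendsto_const_nhds (Eventually.of_forall fun _ => ht)
  have h2 : Tendsto (fun h : ℝ => h) (𝓝[>] 0) (𝓝 0) := nhdsWithin_le_nhds
  have := h1.sub h2
  simp only [id, sub_zero] at this
  exact this.congr fun h => by ring

/-- The step function that takes on `[hk, h(k+1))` the value of `g` at `hk`. -/
noncomputable def gridStep (g : ℝ → ℝ) (h t : ℝ) : ℝ := g (h * (⌊h⁻¹ * t⌋₊ : ℝ))

theorem measurable_gridStep (hg : Measurable g) (h : ℝ) : Measurable (gridStep g h) :=
  hg.comp (((measurable_from_nat (f := fun n : ℕ => (n : ℝ))).comp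
    (Nat.measurable_floor.comp (measurable_id.const_mul h⁻¹))).const_mul h)

theorem abs_gridStep_le {h R M t : ℝ} (hh : 0 < h) (hM : ∀ t ∈ Icc 0 R, |g t| ≤ M)
    (ht : t ∈ Icc 0 R) : |gridStep g h t| ≤ M := by
  refine hM _ ⟨by positivity, le_trans ?_ ht.2⟩
  have h1 := Nat.floor_le (show 0 ≤ h⁻¹ * t from mul_nonneg (inv_pos.2 hh).le ht.1)
  calc h * (⌊h⁻¹ * t⌋₊ : ℝ) ≤ h * (h⁻¹ * t) := by gcongr
    _ = t := by field_simp

theorem intervalIntegrable_of_measurable_of_bounded {f : ℝ → ℝ} {a b M : ℝ} (hf : Measurable f)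
    (hab : a ≤ b) (hM : ∀ t ∈ Icc a b, |f t| ≤ M) :
    IntervalIntegrable f MeasureTheory.volume a b := by
  rw [intervalIntegrable_iff_integrableOn_Ioc_of_le hab]
  refine MeasureTheory.IntegrableOn.of_bound (by simp) hf.aestronglyMeasurable M ?_
  filter_upwards [MeasureTheory.ae_restrict_mem measurableSet_Ioc] with t ht
  exact hM t (Ioc_subset_Icc_self ht)

theorem sum_range_eq_integral_gridStep {h M : ℝ} (hh : 0 < h) (n : ℕ) (hg : Measurable g)
    (hM : ∀ t ∈ Icc 0 (h * n), |g t| ≤ M) :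
    ∑ k ∈ Finset.range n, h * g (h * k) = ∫ t in (0 : ℝ)..(h * n), gridStep g h t := by
  have hcell : ∀ k : ℕ, ∫ t in (h * (k : ℝ))..(h * ((k + 1 : ℕ) : ℝ)), gridStep g h t =
      h * g (h * k) := by
    intro k
    have hle : h * (k : ℝ) ≤ h * ((k + 1 : ℕ) : ℝ) := by gcongr; simp
    rw [intervalIntegral.integral_congr_Ioo_of_le (g := fun _ => g (h * k)) hle]
    · rw [intervalIntegral.integral_const, smul_eq_mul]
      push_cast
      ring
    · intro t ht
      have : ⌊h⁻¹ * t⌋₊ = k := by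
        rw [Nat.floor_eq_iff (mul_nonneg (inv_pos.2 hh).le (le_trans (by positivity) ht.1.le)),
          inv_mul_eq_div, le_div_iff₀ hh, div_lt_iff₀ hh]
        have h1 := ht.1
        have h2 := ht.2
        push_cast at h2
        constructor <;> linarith
      simp only [gridStep, this]
  have hsum := intervalIntegral.sum_integral_adjacent_intervals (f := gridStep g h)
    (μ := MeasureTheory.volume) (a := fun k : ℕ => h * (k : ℝ)) (n := n) (fun k hk => by
      have hle : h * (k : ℝ) ≤ h * ((k + 1 : ℕ) : ℝ) := by gcongr; simp
      have hle' : h * ((k + 1 : ℕ) : ℝ) ≤ h * n := by gcongr; exact_mod_cast hk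
      exact intervalIntegrable_of_measurable_of_bounded (measurable_gridStep hg h) hle
        fun t ht => abs_gridStep_le hh hM ⟨le_trans (by positivity) ht.1, ht.2.trans hle'⟩)
  simp only [hcell] at hsum
  simpa using hsum

/-- Convergence of Riemann sums for a locally bounded, almost everywhere continuous function,
while the upper limit moves. -/
theorem tendsto_sum_range_floor (hg : Measurable g)
    (hM : ∀ R, ∃ M, ∀ t ∈ Icc 0 R, |g t| ≤ M)
    (hc : ∀ᵐ t : ℝ, 0 < t → ContinuousAt g t)
    (hH : Tendsto H l (𝓝[>] 0)) (hS : Tendsto S l (𝓝 s₀)) (hS0 : ∀ᶠ k in l, 0 ≤ S k)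
    (hs₀ : 0 ≤ s₀) :
    Tendsto (fun k => ∑ m ∈ Finset.range (⌊(H k)⁻¹ * S k⌋₊ + 1), H k * g (H k * m)) l
      (𝓝 (∫ t in (0 : ℝ)..s₀, g t)) := by
  set R := s₀ + 1 with hR
  have hR0 : 0 ≤ R := by linarith
  obtain ⟨M, hM⟩ := hM R
  have hdom : Tendsto (fun h => ∫ t in (0 : ℝ)..R, |gridStep g h t - g t|) (𝓝[>] 0) (𝓝 0) := by
    have := intervalIntegral.tendsto_integral_filter_of_dominated_convergence
      (a := 0) (b := R) (μ := MeasureTheory.volume) (l := 𝓝[>] (0 : ℝ))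
      (F := fun h t => |gridStep g h t - g t|) (f := fun _ => 0) (fun _ => 2 * M)
      (Eventually.of_forall fun h =>
        (((measurable_gridStep hg h).sub hg).norm).aestronglyMeasurable)
      (by
        filter_upwards [self_mem_nhdsWithin] with h hh
        refine Eventually.of_forall fun t ht => ?_
        rw [uIoc_of_le hR0] at ht
        have h1 := abs_gridStep_le hh hM (Ioc_subset_Icc_self ht)
        have h2 := hM t (Ioc_subset_Icc_self ht)
        have h3 := abs_sub (gridStep g h t) (g t)
        rw [Real.norm_eq_abs, abs_abs]
        linarith)
      intervalIntegrable_const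
      (by
        filter_upwards [hc] with t ht htR
        rw [uIoc_of_le hR0] at htR
        have h1 : Tendsto (fun h => gridStep g h t) (𝓝[>] 0) (𝓝 (g t)) :=
          (ht htR.1).tendsto.comp (tendsto_mul_floor t htR.1.le)
        simpa using (h1.sub_const (g t)).abs)
    simpa using this
  have hb := tendsto_mul_floor_add_one hH hS hS0
  rw [tendsto_iff_norm_sub_tendsto_zero]
  have hmaj : Tendsto (fun k => (∫ t in (0 : ℝ)..R, |gridStep g (H k) t - g t|) +
      M * |H k * ((⌊(H k)⁻¹ * S k⌋₊ : ℝ) + 1) - s₀|) l (𝓝 0) := by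
    have h1 := (hb.sub_const s₀).abs.const_mul M
    simpa using (hdom.comp hH).add h1
  refine squeeze_zero' (Eventually.of_forall fun k => norm_nonneg _) ?_ hmaj
  filter_upwards [hH.eventually self_mem_nhdsWithin, hS0,
    hb.eventually (gt_mem_nhds (show s₀ < R by linarith))] with k hh hk0 hbR
  have hh : 0 < H k := hh
  set h := H k
  set b := h * ((⌊h⁻¹ * S k⌋₊ : ℝ) + 1) with hbdef
  have hb0 : 0 ≤ b := by positivity
  have hcast : h * ((⌊h⁻¹ * S k⌋₊ + 1 : ℕ) : ℝ) = b := by push_cast; rfl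
  rw [sum_range_eq_integral_gridStep hh _ hg (M := M) (fun t ht => hM t ⟨ht.1, by
    rw [hcast] at ht; linarith [ht.2]⟩), hcast]
  have hstep : ∀ c ∈ Icc 0 R, IntervalIntegrable (gridStep g h) MeasureTheory.volume 0 c :=
    fun c hc => intervalIntegrable_of_measurable_of_bounded (measurable_gridStep hg h) hc.1
      fun t ht => abs_gridStep_le hh hM ⟨ht.1, ht.2.trans hc.2⟩
  have hgint : ∀ c ∈ Icc 0 R, IntervalIntegrable g MeasureTheory.volume 0 c :=
    fun c hc => intervalIntegrable_of_measurable_of_bounded hg hc.1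
      fun t ht => hM t ⟨ht.1, ht.2.trans hc.2⟩
  have hbR' : b ∈ Icc 0 R := ⟨hb0, hbR.le⟩
  have hsR : s₀ ∈ Icc 0 R := ⟨hs₀, by linarith⟩
  have e1 : (∫ t in (0 : ℝ)..b, gridStep g h t) - ∫ t in (0 : ℝ)..s₀, g t =
      (∫ t in (0 : ℝ)..b, (gridStep g h t - g t)) + ∫ t in s₀..b, g t := by
    rw [intervalIntegral.integral_sub (hstep b hbR') (hgint b hbR'),
      ← intervalIntegral.integral_interval_sub_left (hgint b hbR') (hgint s₀ hsR)]
    ring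
  have e2 : ‖∫ t in (0 : ℝ)..b, (gridStep g h t - g t)‖ ≤
      ∫ t in (0 : ℝ)..R, |gridStep g h t - g t| := by
    refine (intervalIntegral.norm_integral_le_integral_norm hb0).trans ?_
    exact intervalIntegral.integral_mono_interval le_rfl hb0 hbR.le
      (Eventually.of_forall fun t => abs_nonneg _)
      ((hstep R ⟨hR0, le_rfl⟩).sub (hgint R ⟨hR0, le_rfl⟩)).norm
  have e3 : ‖∫ t in s₀..b, g t‖ ≤ M * |b - s₀| := by
    refine intervalIntegral.norm_integral_le_of_norm_le_const fun t ht => ?_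
    have ht' := uIoc_subset_uIcc ht
    have hsub : uIcc s₀ b ⊆ Icc 0 R := uIcc_subset_Icc hsR hbR'
    exact hM t (hsub ht')
  rw [e1]
  exact (norm_add_le _ _).trans (add_le_add e2 e3)

end RiemannSum

/-! ### The weight along an axis -/

section Axis

variable {μ μs : ℝ × ℝ → ℝ} {e : ℝ → ℝ × ℝ}

theorem totalWeight_of_mem_quadrantBoundary {x : ℝ × ℝ} (hx : x ∈ quadrantBoundary) :
    totalWeight μ μs x = μ x + μs x := by
  rw [totalWeight, indicator_of_mem hx]

theorem totalWeight_of_mem_openQuadrant {x : ℝ × ℝ} (hx : x ∈ openQuadrant) :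
    totalWeight μ μs x = μ x := by
  rw [totalWeight, indicator_of_notMem, add_zero]
  rintro ⟨-, -, h | h⟩
  · exact hx.1.ne' h
  · exact hx.2.ne' h

theorem totalWeight_nonneg (hμ : ∀ x ∈ closedQuadrant, 0 ≤ μ x) (hμs : IsAdmissibleSource μs)
    {x : ℝ × ℝ} (hx : x ∈ closedQuadrant) : 0 ≤ totalWeight μ μs x :=
  add_nonneg (hμ x hx) (indicator_nonneg hμs.nonneg x)

theorem measurable_totalWeight_axis (hμ : ContinuousOn μ closedQuadrant)
    (hμs : IsAdmissibleSource μs) (he : Continuous e)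
    (hmem : ∀ t, 0 ≤ t → e t ∈ quadrantBoundary) :
    Measurable fun t => totalWeight μ μs (e (max t 0)) := by
  have hmaps : ∀ t, e (max t 0) ∈ quadrantBoundary := fun t => hmem _ (le_max_right _ _)
  have hcont : Continuous fun t => e (max t 0) := he.comp (continuous_id.max continuous_const)
  simp only [totalWeight_of_mem_quadrantBoundary (hmaps _)]
  refine Measurable.add ?_ ?_
  · exact (hμ.comp_continuous hcont
      fun t => quadrantBoundary_subset_closedQuadrant (hmaps t)).measurable
  · refine UpperSemicontinuous.measurable ?_
    rw [← upperSemicontinuousOn_univ_iff]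
    exact hμs.usc.comp hcont.continuousOn fun t _ => hmaps t

/-- A locally finite set of discontinuities is a null set on each axis. -/
theorem ae_continuousAt_totalWeight_axis (hμ : ContinuousOn μ closedQuadrant)
    (hμs : IsAdmissibleSource μs) (he : Continuous e) (hinj : Function.Injective e)
    (hmem : ∀ t, 0 ≤ t → e t ∈ quadrantBoundary) :
    ∀ᵐ t : ℝ, 0 < t → ContinuousAt (fun t => totalWeight μ μs (e (max t 0))) t := by
  have hmaps : ∀ t, e (max t 0) ∈ quadrantBoundary := fun t => hmem _ (le_max_right _ _)
  have hcont : Continuous fun t => e (max t 0) := he.comp (continuous_id.max continuous_const)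
  have hnull : MeasureTheory.volume
      {t : ℝ | 0 < t ∧ ¬ ContinuousWithinAt μs quadrantBoundary (e t)} = 0 := by
    refine MeasureTheory.measure_null_of_locally_null _ fun t ht => ?_
    obtain ⟨V, hV, hfin⟩ := hμs.discontinuities (e t) (hmem t ht.1.le)
    refine ⟨_, inter_mem self_mem_nhdsWithin
      (mem_nhdsWithin_of_mem_nhds (he.continuousAt.preimage_mem_nhds hV)), ?_⟩
    refine Set.Finite.measure_zero ?_ _
    refine (hfin.preimage (f := e) hinj.injOn).subset ?_
    rintro s ⟨hs, hsV⟩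
    exact ⟨⟨hsV, hmem s hs.1.le⟩, hs.2⟩
  rw [MeasureTheory.ae_iff]
  refine MeasureTheory.measure_mono_null (fun t ht => ?_) hnull
  simp only [mem_ofPred_eq, Classical.not_imp] at ht
  refine ⟨ht.1, fun hct => ht.2 ?_⟩
  have hmax : max t 0 = t := max_eq_left ht.1.le
  simp only [totalWeight_of_mem_quadrantBoundary (hmaps _)]
  refine ContinuousAt.add ?_ ?_
  · exact (hμ.comp_continuous hcont
      fun t => quadrantBoundary_subset_closedQuadrant (hmaps t)).continuousAt
  · rw [← hmax] at hct
    rw [← continuousWithinAt_univ]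
    exact ContinuousWithinAt.comp (f := fun t => e (max t 0)) hct
      hcont.continuousWithinAt fun t _ => hmaps t

theorem exists_abs_totalWeight_axis_le (hμ : ContinuousOn μ closedQuadrant)
    (hμs : IsAdmissibleSource μs) (he : Continuous e)
    (hmem : ∀ t, 0 ≤ t → e t ∈ quadrantBoundary) (R : ℝ) :
    ∃ M, ∀ t ∈ Icc 0 R, |totalWeight μ μs (e (max t 0))| ≤ M := by
  have hmaps : ∀ t, e (max t 0) ∈ quadrantBoundary := fun t => hmem _ (le_max_right _ _)
  have hcont : Continuous fun t => e (max t 0) := he.comp (continuous_id.max continuous_const)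
  obtain ⟨M₁, hM₁⟩ := isCompact_Icc.exists_bound_of_continuousOn (s := Icc 0 R)
    (hμ.comp_continuous hcont
      fun t => quadrantBoundary_subset_closedQuadrant (hmaps t)).continuousOn
  obtain ⟨M₂, hM₂⟩ := hμs.bounded
  refine ⟨M₁ + M₂, fun t ht => ?_⟩
  rw [totalWeight_of_mem_quadrantBoundary (hmaps t)]
  refine (abs_add_le _ _).trans (add_le_add (hM₁ t ht) ?_)
  rw [abs_of_nonneg (hμs.nonneg _ (hmaps t))]
  exact hM₂ _ (hmaps t)

/-- Riemann sums of the weight along an axis converge to its integral, while the upper limit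
moves. -/
theorem tendsto_sum_totalWeight_axis {ι : Type*} {l : Filter ι} {H S : ι → ℝ} {s₀ : ℝ}
    (hμ : ContinuousOn μ closedQuadrant) (hμs : IsAdmissibleSource μs) (he : Continuous e)
    (hinj : Function.Injective e) (hmem : ∀ t, 0 ≤ t → e t ∈ quadrantBoundary)
    (hH : Tendsto H l (𝓝[>] 0)) (hS : Tendsto S l (𝓝 s₀)) (hS0 : ∀ᶠ k in l, 0 ≤ S k)
    (hs₀ : 0 ≤ s₀) :
    Tendsto (fun k => ∑ m ∈ Finset.range (⌊(H k)⁻¹ * S k⌋₊ + 1),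
      H k * totalWeight μ μs (e (H k * m))) l
      (𝓝 (∫ t in (0 : ℝ)..s₀, totalWeight μ μs (e t))) := by
  have h1 := tendsto_sum_range_floor (measurable_totalWeight_axis hμ hμs he hmem)
    (exists_abs_totalWeight_axis_le hμ hμs he hmem)
    (ae_continuousAt_totalWeight_axis hμ hμs he hinj hmem) hH hS hS0 hs₀
  have h2 : ∫ t in (0 : ℝ)..s₀, totalWeight μ μs (e (max t 0)) =
      ∫ t in (0 : ℝ)..s₀, totalWeight μ μs (e t) := by
    refine intervalIntegral.integral_congr fun t ht => ?_
    rw [uIcc_of_le hs₀] at ht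
    simp only [max_eq_left ht.1]
  rw [h2] at h1
  refine h1.congr' ?_
  filter_upwards [hH.eventually self_mem_nhdsWithin] with k hk
  have hk : 0 < H k := hk
  refine Finset.sum_congr rfl fun m _ => ?_
  rw [max_eq_left (by positivity)]

theorem boundaryDatum_left (s : ℝ) :
    boundaryDatum μ μs (s, 0) = ∫ t in (0 : ℝ)..s, totalWeight μ μs (t, 0) := by
  have := intervalIntegral.smul_integral_comp_mul_right (a := 0) (b := 1)
    (fun t => totalWeight μ μs (t, 0)) s
  simpa [boundaryDatum] using this

theorem boundaryDatum_right (s : ℝ) :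
    boundaryDatum μ μs (0, s) = ∫ t in (0 : ℝ)..s, totalWeight μ μs (0, t) := by
  have := intervalIntegral.smul_integral_comp_mul_right (a := 0) (b := 1)
    (fun t => totalWeight μ μs (0, t)) s
  simpa [boundaryDatum] using this

end Axis

/-! ### Linear complexity of the scheme -/

/-- Address of the value at the grid point number `N` in row-by-row order: three constants come
first, and each grid point takes fifteen instructions, of which the last yields the value. -/
def valueAddress (N : ℕ) : ℕ := 3 + 15 * N + 14

/-- The instructions that compute the update from the values at the addresses `A` (left) and `B`
(below); `b` is the address of the first of them.  Addresses `0, 1, 2` hold `0`, `1/2` and `h`. -/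
def updateBlock (i j A B b : ℕ) : List ArithInstr :=
  [.input (.weight i j), .input (.variance i j), .add A B, .sub A B, .mul (b + 3) (b + 3),
    .mul 2 2, .mul (b + 5) (b + 1), .add (b + 6) (b + 6), .add (b + 7) (b + 7),
    .add (b + 4) (b + 8), .sqrt (b + 9), .add (b + 2) (b + 10), .mul 1 (b + 11), .mul 2 b,
    .add (b + 12) (b + 13)]

/-- The block for the grid point number `N` of a grid with rows of length `n + 1`.  Missing
neighbours are read from address `0`, which holds `0`. -/
def gridBlock (n N : ℕ) : List ArithInstr :=
  updateBlock (N / (n + 1)) (N % (n + 1))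
    (if N / (n + 1) = 0 then 0 else valueAddress (N - (n + 1)))
    (if N % (n + 1) = 0 then 0 else valueAddress (N - 1)) (3 + 15 * N)

/-- The program for the first `N` grid points. -/
def gridProgram (n : ℕ) : ℕ → List ArithInstr
  | 0 => [.const 0, .const (1 / 2), .input .spacing]
  | N + 1 => gridProgram n N ++ gridBlock n N

theorem length_gridProgram (n N : ℕ) : (gridProgram n N).length = 3 + 15 * N := by
  induction N with
  | zero => rfl
  | succ N ih => simp [gridProgram, ih, gridBlock, updateBlock]; ring

/-- Running one block appends fifteen numbers, the last of which is the update. -/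
theorem foldl_updateBlock (d : GridInput → ℝ) (mem : List ℝ) (i j A B : ℕ)
    (hA : A < mem.length) (hB : B < mem.length) (hlen : 3 ≤ mem.length)
    (h1 : mem[1]? = some (1 / 2)) (h2 : mem[2]? = some (d .spacing)) :
    ∃ l : List ℝ, l.length = 15 ∧
      (updateBlock i j A B mem.length).foldl (fun mem c => mem ++ [c.eval d mem]) mem = mem ++ l ∧
      l[14]? = some (schemeUpdate (d .spacing) (d (.weight i j)) (d (.variance i j))
        (mem.getD A 0) (mem.getD B 0)) := by
  have old : ∀ (l : List ℝ) (k : ℕ), k < mem.length → (mem ++ l).getD k 0 = mem.getD k 0 :=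
    fun l k hk => List.getD_append _ _ _ _ hk
  have new : ∀ (l : List ℝ) (k : ℕ), (mem ++ l).getD (mem.length + k) 0 = l.getD k 0 := by
    intro l k
    rw [List.getD_append_right _ _ _ _ (by omega)]
    simp
  have new0 : ∀ l : List ℝ, (mem ++ l).getD mem.length 0 = l.getD 0 0 := fun l => new l 0
  have m1 : mem.getD 1 0 = 1 / 2 := by simp [List.getD_eq_getElem?_getD, h1]
  have m2 : mem.getD 2 0 = d .spacing := by simp [List.getD_eq_getElem?_getD, h2]
  simp only [updateBlock, List.foldl_cons, List.foldl_nil, ArithInstr.eval, List.append_assoc,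
    List.cons_append, List.nil_append, new, new0, old _ A hA, old _ B hB,
    old _ 1 (show 1 < mem.length by omega), old _ 2 (show 2 < mem.length by omega), m1, m2]
  refine ⟨_, ?_, rfl, ?_⟩
  · simp
  · simp [schemeUpdate]
    ring_nf

/-- Invariant of the program: after `N` grid points the values computed so far are at their
addresses. -/
theorem runProgram_gridProgram (μ μs σ : ℝ × ℝ → ℝ) (h : ℝ) (n N : ℕ) :
    let mem := runProgram (schemeInput μ μs σ h) (gridProgram n N)
    mem.length = 3 + 15 * N ∧ mem[0]? = some 0 ∧ mem[1]? = some (1 / 2) ∧ mem[2]? = some h ∧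
      ∀ k < N, mem[valueAddress k]? =
        some (schemeValue μ μs σ h (k / (n + 1)) (k % (n + 1))) := by
  induction N with
  | zero => simp [runProgram, gridProgram, ArithInstr.eval, schemeInput]
  | succ N ih =>
    simp only at ih ⊢
    set mem := runProgram (schemeInput μ μs σ h) (gridProgram n N) with hmem
    obtain ⟨hlen, h0, h1, h2, hval⟩ := ih
    set i := N / (n + 1) with hi
    set j := N % (n + 1) with hj
    set A := if i = 0 then 0 else valueAddress (N - (n + 1)) with hA
    set B := if j = 0 then 0 else valueAddress (N - 1) with hB
    have hN : (n + 1) * i + j = N := Nat.div_add_mod N (n + 1)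
    have hjn : j < n + 1 := Nat.mod_lt _ (by omega)
    have hA' : A < mem.length := by
      simp only [hA, valueAddress]
      split_ifs with hc
      · omega
      · have : n + 1 ≤ (n + 1) * i := Nat.le_mul_of_pos_right _ (Nat.pos_of_ne_zero hc)
        omega
    have hB' : B < mem.length := by
      simp only [hB, valueAddress]
      split_ifs with hc
      · omega
      · omega
    obtain ⟨l, hl, hrun, hlast⟩ := foldl_updateBlock (schemeInput μ μs σ h) mem i j A B hA' hB'
      (by omega) h1 h2
    have hrun' : runProgram (schemeInput μ μs σ h) (gridProgram n (N + 1)) = mem ++ l := by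
      rw [← hrun, runProgram, gridProgram, List.foldl_append, hlen]
      rfl
    rw [hrun']
    refine ⟨by simp [hlen, hl]; ring, ?_, ?_, ?_, fun k hk => ?_⟩
    · rw [List.getElem?_append_left (by omega), h0]
    · rw [List.getElem?_append_left (by omega), h1]
    · rw [List.getElem?_append_left (by omega), h2]
    rcases Nat.lt_succ_iff_lt_or_eq.1 hk with hk | rfl
    · rw [List.getElem?_append_left (by simp only [valueAddress]; omega), hval k hk]
    rw [← hi, ← hj, List.getElem?_append_right (by simp only [valueAddress]; omega)]
    have : valueAddress k - mem.length = 14 := by simp only [valueAddress]; omega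
    rw [this, hlast]
    congr 1
    have e0 : mem.getD 0 0 = 0 := by simp [List.getD_eq_getElem?_getD, h0]
    -- the left and lower neighbours have numbers `k - (n + 1)` and `k - 1`
    have eA : ∀ i', i = i' + 1 → mem.getD A 0 = schemeValue μ μs σ h i' j := by
      intro i' hi'
      have e1 : A = valueAddress (k - (n + 1)) := by simp [hA, hi']
      have e2 : k - (n + 1) = j + (n + 1) * i' := by
        rw [hi', mul_add, mul_one] at hN
        omega
      have e3 : k - (n + 1) < k := by
        rw [hi', mul_add, mul_one] at hN
        omega
      rw [List.getD_eq_getElem?_getD, e1, hval _ e3, e2, Nat.add_mul_div_left _ _ (by omega),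
        Nat.add_mul_mod_self_left, Nat.div_eq_of_lt hjn, Nat.mod_eq_of_lt hjn]
      simp
    have eB : ∀ j', j = j' + 1 → mem.getD B 0 = schemeValue μ μs σ h i j' := by
      intro j' hj'
      have e1 : B = valueAddress (k - 1) := by simp [hB, hj']
      have e2 : k - 1 = j' + (n + 1) * i := by omega
      have e3 : j' < n + 1 := by omega
      rw [List.getD_eq_getElem?_getD, e1, hval _ (by omega), e2,
        Nat.add_mul_div_left _ _ (by omega), Nat.add_mul_mod_self_left, Nat.div_eq_of_lt e3, Nat.mod_eq_of_lt e3]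
      simp
    have eA0 : i = 0 → mem.getD A 0 = 0 := fun hc => by rw [hA, if_pos hc, e0]
    have eB0 : j = 0 → mem.getD B 0 = 0 := fun hc => by rw [hB, if_pos hc, e0]
    clear_value i j A B
    rcases i with _ | i <;> rcases j with _ | j
    · rw [eA0 rfl, eB0 rfl]; simp [schemeValue, schemeInput]
    · rw [eA0 rfl, eB j rfl]; simp [schemeValue, schemeInput]
    · rw [eA i rfl, eB0 rfl]; simp [schemeValue, schemeInput]
    · rw [eA i rfl, eB j rfl]; simp [schemeValue, schemeInput]

theorem schemeHasLinearComplexity : SchemeHasLinearComplexity := by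
  refine ⟨18, fun m n => ⟨gridProgram n ((m + 1) * (n + 1)),
    fun i j => valueAddress (i * (n + 1) + j), ?_, ?_⟩⟩
  · rw [length_gridProgram]
    have : 1 ≤ (m + 1) * (n + 1) := Nat.mul_pos (by omega) (by omega)
    omega
  · intro μ μs σ h _ i j hi hj
    have hlt : i * (n + 1) + j < (m + 1) * (n + 1) := by nlinarith
    rw [(runProgram_gridProgram μ μs σ h n _).2.2.2.2 _ hlt]
    have e1 : (i * (n + 1) + j) / (n + 1) = i := by
      rw [add_comm, Nat.add_mul_div_right _ _ (by omega), Nat.div_eq_of_lt (by omega), zero_add]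
    have e2 : (i * (n + 1) + j) % (n + 1) = j := by
      rw [add_comm, Nat.add_mul_mod_self_right, Nat.mod_eq_of_lt (by omega)]
    rw [e1, e2]

/-! ### Relaxed limits of the numerical solution -/

section Convergence

variable {μ μs σ : ℝ × ℝ → ℝ}

theorem schemeExtension_gridPoint {h : ℝ} (hh : 0 < h) (i j : ℕ) :
    schemeExtension μ μs σ h (gridPoint h i j) = schemeValue μ μs σ h i j := by
  simp [schemeExtension, gridPoint, hh.ne']

theorem schemeExtension_eq_gridPoint {h : ℝ} (hh : 0 < h) (y : ℝ × ℝ) :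
    schemeExtension μ μs σ h y =
      schemeExtension μ μs σ h (gridPoint h ⌊h⁻¹ * y.1⌋₊ ⌊h⁻¹ * y.2⌋₊) := by
  rw [schemeExtension_gridPoint hh]
  rfl

theorem monotoneOn_schemeExtension (hw : ∀ x ∈ closedQuadrant, 0 ≤ totalWeight μ μs x) {h : ℝ}
    (hh : 0 < h) : MonotoneOn (schemeExtension μ μs σ h) closedQuadrant := by
  intro x _ y _ hxy
  have hi := (inv_pos.2 hh).le
  exact schemeValue_mono hw hh.le (Nat.floor_mono (mul_le_mul_of_nonneg_left hxy.1 hi))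
    (Nat.floor_mono (mul_le_mul_of_nonneg_left hxy.2 hi))

theorem eventually_relaxedFilter_nonneg (x : ℝ × ℝ) :
    ∀ᶠ p in relaxedFilter x, 0 < p.1 ∧ 0 ≤ p.2.1 ∧ 0 ≤ p.2.2 :=
  ((tendsto_fst_relaxedFilter x).eventually self_mem_nhdsWithin).and
    ((tendsto_snd_relaxedFilter x).eventually self_mem_nhdsWithin)

theorem tendsto_snd_fst_relaxedFilter (x : ℝ × ℝ) :
    Tendsto (fun p : ℝ × (ℝ × ℝ) => p.2.1) (relaxedFilter x) (𝓝 x.1) :=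
  (continuous_fst.tendsto x).comp
    ((tendsto_snd_relaxedFilter x).mono_right nhdsWithin_le_nhds)

theorem tendsto_snd_snd_relaxedFilter (x : ℝ × ℝ) :
    Tendsto (fun p : ℝ × (ℝ × ℝ) => p.2.2) (relaxedFilter x) (𝓝 x.2) :=
  (continuous_snd.tendsto x).comp
    ((tendsto_snd_relaxedFilter x).mono_right nhdsWithin_le_nhds)

theorem tendsto_sum_weight_left (hμ : ContinuousOn μ closedQuadrant)
    (hμs : IsAdmissibleSource μs) {x : ℝ × ℝ} (hx : x ∈ closedQuadrant) :
    Tendsto (fun p : ℝ × (ℝ × ℝ) => ∑ k ∈ Finset.range (⌊p.1⁻¹ * p.2.1⌋₊ + 1),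
      p.1 * totalWeight μ μs (gridPoint p.1 k 0)) (relaxedFilter x)
      (𝓝 (boundaryDatum μ μs (x.1, 0))) := by
  have := tendsto_sum_totalWeight_axis (e := fun t => (t, 0)) hμ hμs (by fun_prop)
    (fun s t hst => (Prod.ext_iff.1 hst).1) (fun t ht => ⟨ht, le_rfl, Or.inr rfl⟩)
    (tendsto_fst_relaxedFilter x) (tendsto_snd_fst_relaxedFilter x)
    ((eventually_relaxedFilter_nonneg x).mono fun p hp => hp.2.1) hx.1
  rw [boundaryDatum_left]
  simpa [gridPoint] using this

theorem tendsto_sum_weight_right (hμ : ContinuousOn μ closedQuadrant)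
    (hμs : IsAdmissibleSource μs) {x : ℝ × ℝ} (hx : x ∈ closedQuadrant) :
    Tendsto (fun p : ℝ × (ℝ × ℝ) => ∑ k ∈ Finset.range (⌊p.1⁻¹ * p.2.2⌋₊ + 1),
      p.1 * totalWeight μ μs (gridPoint p.1 0 k)) (relaxedFilter x)
      (𝓝 (boundaryDatum μ μs (0, x.2))) := by
  have := tendsto_sum_totalWeight_axis (e := fun t => (0, t)) hμ hμs (by fun_prop)
    (fun s t hst => (Prod.ext_iff.1 hst).2) (fun t ht => ⟨le_rfl, ht, Or.inl rfl⟩)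
    (tendsto_fst_relaxedFilter x) (tendsto_snd_snd_relaxedFilter x)
    ((eventually_relaxedFilter_nonneg x).mono fun p hp => hp.2.2) hx.2
  rw [boundaryDatum_right]
  simpa [gridPoint] using this

theorem tendsto_schemeBarrier (hμ : ContinuousOn μ closedQuadrant)
    (hμs : IsAdmissibleSource μs) {x : ℝ × ℝ} (hx : x ∈ closedQuadrant) (L s : ℝ) :
    Tendsto (fun p : ℝ × (ℝ × ℝ) => schemeBarrier (totalWeight μ μs) L s p.1
      ⌊p.1⁻¹ * p.2.1⌋₊ ⌊p.1⁻¹ * p.2.2⌋₊) (relaxedFilter x)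
      (𝓝 (boundaryDatum μ μs (x.1, 0) + boundaryDatum μ μs (0, x.2) + L * x.1 * x.2 +
        2 * s * (√x.1 * √x.2))) := by
  have h1 := tendsto_mul_floor_add_one (tendsto_fst_relaxedFilter x)
    (tendsto_snd_fst_relaxedFilter x)
    ((eventually_relaxedFilter_nonneg x).mono fun p hp => hp.2.1)
  have h2 := tendsto_mul_floor_add_one (tendsto_fst_relaxedFilter x)
    (tendsto_snd_snd_relaxedFilter x)
    ((eventually_relaxedFilter_nonneg x).mono fun p hp => hp.2.2)
  have h3 := (((tendsto_sum_weight_left hμ hμs hx).add (tendsto_sum_weight_right hμ hμs hx)).add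
    ((h1.const_mul L).mul h2)).add ((h1.sqrt.mul h2.sqrt).const_mul (2 * s))
  refine h3.congr' ?_
  filter_upwards [eventually_relaxedFilter_nonneg x] with p hp
  rw [schemeBarrier, Real.sqrt_mul hp.1.le, Real.sqrt_mul hp.1.le]
  linear_combination (2 * s * √((⌊p.1⁻¹ * p.2.1⌋₊ : ℝ) + 1) *
    √((⌊p.1⁻¹ * p.2.2⌋₊ : ℝ) + 1)) * Real.mul_self_sqrt hp.1.le

/-- The barrier applies near every point, with `s²` a bound for `σ²` on a square that contains a
neighbourhood of the point. -/
theorem exists_eventually_schemeExtension_le (hμ_nonneg : ∀ x ∈ closedQuadrant, 0 ≤ μ x)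
    (hμ_lip : ∃ K : NNReal, LipschitzOnWith K μ closedQuadrant)
    (hσ : ContinuousOn (fun x => σ x ^ 2) closedQuadrant)
    (hμs : IsAdmissibleSource μs) (x : ℝ × ℝ) :
    ∃ L s : ℝ, ∀ᶠ p in relaxedFilter x, schemeExtension μ μs σ p.1 p.2 ≤
      schemeBarrier (totalWeight μ μs) L s p.1 ⌊p.1⁻¹ * p.2.1⌋₊ ⌊p.1⁻¹ * p.2.2⌋₊ := by
  obtain ⟨L, hL0, hL⟩ := exists_abs_sub_le_of_lipschitzOnWith hμ_lip
  set R := max x.1 x.2 + 1 with hR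
  have hKQ : Icc 0 R ×ˢ Icc 0 R ⊆ closedQuadrant := fun x hx => ⟨hx.1.1, hx.2.1⟩
  obtain ⟨C, hC⟩ := (isCompact_Icc.prod isCompact_Icc).exists_bound_of_continuousOn
    (hσ.mono hKQ)
  refine ⟨L, √C, ?_⟩
  have hw := fun (y : ℝ × ℝ) hy => totalWeight_nonneg (x := y) hμ_nonneg hμs hy
  filter_upwards [eventually_relaxedFilter_nonneg x,
    (tendsto_snd_fst_relaxedFilter x).eventually
      (gt_mem_nhds (show x.1 < R by linarith [le_max_left x.1 x.2])),
    (tendsto_snd_snd_relaxedFilter x).eventually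
      (gt_mem_nhds (show x.2 < R by linarith [le_max_right x.1 x.2]))] with p hp h1 h2
  have hfloor : ∀ t, 0 ≤ t → t < R → p.1 * (⌊p.1⁻¹ * t⌋₊ : ℝ) ≤ R := by
    intro t ht htR
    have h3 := Nat.floor_le (mul_nonneg (inv_pos.2 hp.1).le ht)
    calc p.1 * (⌊p.1⁻¹ * t⌋₊ : ℝ) ≤ p.1 * (p.1⁻¹ * t) := mul_le_mul_of_nonneg_left h3 hp.1.le
      _ = t := mul_inv_cancel_left₀ hp.1.ne' t
      _ ≤ R := htR.le
  refine schemeValue_le_schemeBarrier hw hp.1.le hL0 (Real.sqrt_nonneg C) (fun y hy => ?_)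
    (fun y hy hy1 hy2 => ?_) _ _ (hfloor _ hp.2.1 h1) (hfloor _ hp.2.2 h2)
  · have hyQ := openQuadrant_subset_closedQuadrant hy
    have m1 : ((y.1, 0) : ℝ × ℝ) ∈ quadrantBoundary := ⟨hyQ.1, le_rfl, Or.inr rfl⟩
    have m2 : ((0, y.2) : ℝ × ℝ) ∈ quadrantBoundary := ⟨le_rfl, hyQ.2, Or.inl rfl⟩
    have l1 := (abs_le.1 (hL y hyQ _ (quadrantBoundary_subset_closedQuadrant m1))).2
    have l2 := (abs_le.1 (hL y hyQ _ (quadrantBoundary_subset_closedQuadrant m2))).2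
    rw [totalWeight_of_mem_openQuadrant hy, totalWeight_of_mem_quadrantBoundary m1,
      totalWeight_of_mem_quadrantBoundary m2]
    simp only [sub_self, sub_zero, abs_zero, zero_add, add_zero, abs_of_nonneg hyQ.1,
      abs_of_nonneg hyQ.2] at l1 l2
    exact ⟨by linarith [hμs.nonneg _ m1], by linarith [hμs.nonneg _ m2]⟩
  · have h3 := hC y ⟨⟨hy.1, hy1⟩, ⟨hy.2, hy2⟩⟩
    have h4 := (le_abs_self _).trans h3
    rw [Real.sq_sqrt (le_trans (sq_nonneg _) h4)]
    exact h4

theorem isLocallyBoundedFamily_schemeExtension (hμ_nonneg : ∀ x ∈ closedQuadrant, 0 ≤ μ x)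
    (hμ_lip : ∃ K : NNReal, LipschitzOnWith K μ closedQuadrant)
    (hσ : ContinuousOn (fun x => σ x ^ 2) closedQuadrant)
    (hμs : IsAdmissibleSource μs) : IsLocallyBoundedFamily (schemeExtension μ μs σ) := by
  intro x hx
  obtain ⟨K, hK⟩ := hμ_lip
  obtain ⟨L, s, hLs⟩ := exists_eventually_schemeExtension_le hμ_nonneg ⟨K, hK⟩ hσ hμs x
  have hlim := (tendsto_schemeBarrier hK.continuousOn hμs hx L s).eventually
    (gt_mem_nhds (lt_add_one _))
  refine ⟨boundaryDatum μ μs (x.1, 0) + boundaryDatum μ μs (0, x.2) + L * x.1 * x.2 +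
    2 * s * (√x.1 * √x.2) + 1, ?_⟩
  filter_upwards [hLs, hlim, eventually_relaxedFilter_nonneg x] with p h1 h2 h3
  have hw := fun (y : ℝ × ℝ) hy => totalWeight_nonneg (x := y) hμ_nonneg hμs hy
  have h4 : 0 ≤ schemeExtension μ μs σ p.1 p.2 := by
    refine le_trans ?_ (schemeValue_mono hw h3.1.le (Nat.zero_le _) (Nat.zero_le _))
    refine le_trans ?_ (sum_weight_le_schemeValue_left 0)
    exact Finset.sum_nonneg fun k _ =>
      mul_nonneg h3.1.le (hw _ (gridPoint_mem_closedQuadrant h3.1.le k 0))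
  rw [abs_of_nonneg h4]
  exact h1.trans h2.le

/-- On an axis the limit of the barrier is the boundary datum: its other terms vanish there. -/
theorem upperRelaxedLimit_schemeExtension_le_boundaryDatum
    (hμ_nonneg : ∀ x ∈ closedQuadrant, 0 ≤ μ x)
    (hμ_lip : ∃ K : NNReal, LipschitzOnWith K μ closedQuadrant)
    (hσ : ContinuousOn (fun x => σ x ^ 2) closedQuadrant)
    (hμs : IsAdmissibleSource μs) {x : ℝ × ℝ} (hx : x ∈ quadrantBoundary) :
    upperRelaxedLimit (schemeExtension μ μs σ) x ≤ boundaryDatum μ μs x := by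
  have hb := isLocallyBoundedFamily_schemeExtension hμ_nonneg hμ_lip hσ hμs
  have hxQ := quadrantBoundary_subset_closedQuadrant hx
  obtain ⟨L, s, hLs⟩ := exists_eventually_schemeExtension_le hμ_nonneg hμ_lip hσ hμs x
  obtain ⟨K, hK⟩ := hμ_lip
  have hlim := tendsto_schemeBarrier hK.continuousOn hμs hxQ L s
  have hval : boundaryDatum μ μs (x.1, 0) + boundaryDatum μ μs (0, x.2) + L * x.1 * x.2 +
      2 * s * (√x.1 * √x.2) = boundaryDatum μ μs x := by
    obtain ⟨x₁, x₂⟩ := x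
    obtain ⟨-, -, rfl | rfl⟩ := hx
    · simp [boundaryDatum_left]
    · simp [boundaryDatum_right]
  rw [hval] at hlim
  refine le_of_forall_pos_le_add fun ε hε => hb.upperRelaxedLimit_le hxQ ?_
  filter_upwards [hLs, hlim.eventually (gt_mem_nhds (lt_add_of_pos_right _ hε))] with p h1 h2
  exact h1.trans h2.le

/-- By monotonicity the numerical solution is at least its value at the projection to an axis. -/
theorem boundaryDatum_le_lowerRelaxedLimit_schemeExtension
    (hμ_nonneg : ∀ x ∈ closedQuadrant, 0 ≤ μ x)
    (hμ_lip : ∃ K : NNReal, LipschitzOnWith K μ closedQuadrant)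
    (hσ : ContinuousOn (fun x => σ x ^ 2) closedQuadrant)
    (hμs : IsAdmissibleSource μs) {x : ℝ × ℝ} (hx : x ∈ quadrantBoundary) :
    boundaryDatum μ μs x ≤ -upperRelaxedLimit (fun h y => -schemeExtension μ μs σ h y) x := by
  have hb := (isLocallyBoundedFamily_schemeExtension hμ_nonneg hμ_lip hσ hμs).neg
  have hxQ := quadrantBoundary_subset_closedQuadrant hx
  obtain ⟨K, hK⟩ := hμ_lip
  have hw := fun (y : ℝ × ℝ) hy => totalWeight_nonneg (x := y) hμ_nonneg hμs hy
  rw [le_neg]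
  refine le_of_forall_pos_le_add fun ε hε => hb.upperRelaxedLimit_le hxQ ?_
  obtain ⟨x₁, x₂⟩ := x
  obtain ⟨-, -, rfl | rfl⟩ := hx
  · have hlim := tendsto_sum_weight_right hK.continuousOn hμs hxQ
    filter_upwards [hlim.eventually (lt_mem_nhds (sub_lt_self _ hε)),
      eventually_relaxedFilter_nonneg _] with p h1 h2
    have h3 : _ ≤ schemeExtension μ μs σ p.1 p.2 := (sum_weight_le_schemeValue_right _).trans
      (schemeValue_mono hw h2.1.le (Nat.zero_le _) le_rfl)
    linarith
  · have hlim := tendsto_sum_weight_left hK.continuousOn hμs hxQ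
    filter_upwards [hlim.eventually (lt_mem_nhds (sub_lt_self _ hε)),
      eventually_relaxedFilter_nonneg _] with p h1 h2
    have h3 : _ ≤ schemeExtension μ μs σ p.1 p.2 := (sum_weight_le_schemeValue_left _).trans
      (schemeValue_mono hw h2.1.le le_rfl (Nat.zero_le _))
    linarith

/-- The scheme at an interior grid point, as an equation for the backward differences. -/
theorem backward_difference_mul_backward_difference {h : ℝ} (hh : 0 < h) (i j : ℕ) :
    0 ≤ schemeExtension μ μs σ h (gridPoint h (i + 1) (j + 1)) -
        schemeExtension μ μs σ h (gridPoint h i (j + 1)) - h * μ (gridPoint h (i + 1) (j + 1)) ∧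
    0 ≤ schemeExtension μ μs σ h (gridPoint h (i + 1) (j + 1)) -
        schemeExtension μ μs σ h (gridPoint h (i + 1) j) - h * μ (gridPoint h (i + 1) (j + 1)) ∧
    (schemeExtension μ μs σ h (gridPoint h (i + 1) (j + 1)) -
        schemeExtension μ μs σ h (gridPoint h i (j + 1)) - h * μ (gridPoint h (i + 1) (j + 1))) *
      (schemeExtension μ μs σ h (gridPoint h (i + 1) (j + 1)) -
        schemeExtension μ μs σ h (gridPoint h (i + 1) j) - h * μ (gridPoint h (i + 1) (j + 1))) =
      h ^ 2 * σ (gridPoint h (i + 1) (j + 1)) ^ 2 := by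
  have hO : gridPoint h (i + 1) (j + 1) ∈ openQuadrant :=
    ⟨by simp only [gridPoint]; positivity, by simp only [gridPoint]; positivity⟩
  simp only [schemeExtension_gridPoint hh]
  rw [schemeValue_succ_succ, totalWeight_of_mem_openQuadrant hO]
  have h1 := add_mul_le_schemeUpdate (h := h) (m := μ (gridPoint h (i + 1) (j + 1)))
    (a := schemeValue μ μs σ h i (j + 1)) (b := schemeValue μ μs σ h (i + 1) j)
    (sq_nonneg (σ (gridPoint h (i + 1) (j + 1))))
  exact ⟨by linarith, by linarith, schemeUpdate_sub_mul_sub (sq_nonneg _) _ _⟩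

/-- Vectors below the difference quotients `dᵢ / h` satisfy the subsolution inequality. -/
theorem max_sub_mul_max_sub_le {h m s p₁ p₂ d₁ d₂ : ℝ} (hh : 0 < h) (h₁ : 0 ≤ d₁ - h * m)
    (h₂ : 0 ≤ d₂ - h * m) (hd₁ : h * p₁ ≤ d₁) (hd₂ : h * p₂ ≤ d₂)
    (heq : (d₁ - h * m) * (d₂ - h * m) = h ^ 2 * s ^ 2) :
    max (p₁ - m) 0 * max (p₂ - m) 0 - s ^ 2 ≤ 0 := by
  have e1 : h * max (p₁ - m) 0 ≤ d₁ - h * m := by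
    rw [mul_max_of_nonneg _ _ hh.le]
    exact max_le (by linarith) (by simpa using h₁)
  have e2 : h * max (p₂ - m) 0 ≤ d₂ - h * m := by
    rw [mul_max_of_nonneg _ _ hh.le]
    exact max_le (by linarith) (by simpa using h₂)
  have e3 := mul_le_mul e1 e2 (mul_nonneg hh.le (le_max_right _ _)) h₁
  have e4 : h ^ 2 * (max (p₁ - m) 0 * max (p₂ - m) 0) ≤ h ^ 2 * s ^ 2 := by linarith
  linarith [le_of_mul_le_mul_left e4 (by positivity)]

/-- Vectors above the difference quotients `dᵢ / h` satisfy the supersolution inequality. -/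
theorem le_max_sub_mul_max_sub {h m s p₁ p₂ d₁ d₂ : ℝ} (hh : 0 < h)
    (h₂ : 0 ≤ d₂ - h * m) (hd₁ : d₁ ≤ h * p₁) (hd₂ : d₂ ≤ h * p₂)
    (heq : (d₁ - h * m) * (d₂ - h * m) = h ^ 2 * s ^ 2) :
    0 ≤ max (p₁ - m) 0 * max (p₂ - m) 0 - s ^ 2 := by
  have e1 : d₁ - h * m ≤ h * max (p₁ - m) 0 := by
    rw [mul_max_of_nonneg _ _ hh.le]
    exact le_max_of_le_left (by linarith)
  have e2 : d₂ - h * m ≤ h * max (p₂ - m) 0 := by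
    rw [mul_max_of_nonneg _ _ hh.le]
    exact le_max_of_le_left (by linarith)
  have e3 := mul_le_mul e1 e2 h₂ (mul_nonneg hh.le (le_max_right _ _))
  have e4 : h ^ 2 * s ^ 2 ≤ h ^ 2 * (max (p₁ - m) 0 * max (p₂ - m) 0) := by linarith
  linarith [le_of_mul_le_mul_left e4 (by positivity)]

/-- The upper relaxed limit is a subsolution.  A violation at `(x, p)` persists for nearby
`(z, q)`, and so contradicts the scheme at a suitable grid point `z`. -/
theorem hamiltonian_nonpos_of_isSuperdifferential (hμ : ContinuousOn μ closedQuadrant)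
    (hσ : ContinuousOn (fun x => σ x ^ 2) closedQuadrant)
    (hb : IsLocallyBoundedFamily (schemeExtension μ μs σ)) {x p : ℝ × ℝ} (hx : x ∈ openQuadrant)
    (hp : IsSuperdifferential openQuadrant (upperRelaxedLimit (schemeExtension μ μs σ)) x p) :
    hamiltonian μ σ x p ≤ 0 := by
  by_contra! hlt
  obtain ⟨r, hr0, hr⟩ := Metric.nhds_basis_ball.mem_iff.1
    ((tendsto_hamiltonian hμ hσ hx p).eventually (lt_mem_nhds hlt))
  obtain ⟨h, hh, i, j, hz, h1, h2⟩ := exists_gridPoint_backward_difference_ge hb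
    (fun h hh y _ => schemeExtension_eq_gridPoint hh y) hx hp (ε := r / 4) (ρ := r)
    (by linarith) hr0
  obtain ⟨d1, d2, d3⟩ := backward_difference_mul_backward_difference (μ := μ) (μs := μs) (σ := σ)
    hh i j
  have h3 := max_sub_mul_max_sub_le hh d1 d2 h1 h2 d3
  have h4 : 0 < hamiltonian μ σ (gridPoint h (i + 1) (j + 1))
      (p.1 - 2 * (r / 4), p.2 - 2 * (r / 4)) := by
    refine @hr (gridPoint h (i + 1) (j + 1), (p.1 - 2 * (r / 4), p.2 - 2 * (r / 4))) ?_
    rw [Metric.mem_ball, dist_eq_norm]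
    refine max_lt hz (max_lt ?_ ?_) <;> simp [abs_of_pos hr0] <;> linarith
  exact absurd h3 (not_le.2 h4)

/-- The lower relaxed limit is a supersolution, by the same argument for `-U^h`. -/
theorem hamiltonian_nonneg_of_isSubdifferential (hμ : ContinuousOn μ closedQuadrant)
    (hσ : ContinuousOn (fun x => σ x ^ 2) closedQuadrant)
    (hb : IsLocallyBoundedFamily (schemeExtension μ μs σ)) {x p : ℝ × ℝ} (hx : x ∈ openQuadrant)
    (hp : IsSubdifferential openQuadrant
      (fun x => -upperRelaxedLimit (fun h y => -schemeExtension μ μs σ h y) x) x p) :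
    0 ≤ hamiltonian μ σ x p := by
  by_contra! hlt
  obtain ⟨r, hr0, hr⟩ := Metric.nhds_basis_ball.mem_iff.1
    ((tendsto_hamiltonian hμ hσ hx p).eventually (gt_mem_nhds hlt))
  have hp' : IsSuperdifferential openQuadrant
      (upperRelaxedLimit fun h y => -schemeExtension μ μs σ h y) x (-p) := by
    intro ε hε
    filter_upwards [hp ε hε] with y hy
    simp only [Prod.fst_neg, Prod.snd_neg]
    linarith
  obtain ⟨h, hh, i, j, hz, h1, h2⟩ := exists_gridPoint_backward_difference_ge hb.neg
    (fun h hh y _ => by rw [schemeExtension_eq_gridPoint hh y]) hx hp' (ε := r / 4) (ρ := r)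
    (by linarith) hr0
  obtain ⟨d1, d2, d3⟩ := backward_difference_mul_backward_difference (μ := μ) (μs := μs) (σ := σ)
    hh i j
  simp only [Prod.fst_neg, Prod.snd_neg] at h1 h2
  have h3 := le_max_sub_mul_max_sub (p₁ := p.1 + 2 * (r / 4)) (p₂ := p.2 + 2 * (r / 4)) hh d2
    (by linarith) (by linarith) d3
  have h4 : hamiltonian μ σ (gridPoint h (i + 1) (j + 1))
      (p.1 + 2 * (r / 4), p.2 + 2 * (r / 4)) < 0 := by
    refine @hr (gridPoint h (i + 1) (j + 1), (p.1 + 2 * (r / 4), p.2 + 2 * (r / 4))) ?_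
    rw [Metric.mem_ball, dist_eq_norm]
    refine max_lt hz (max_lt ?_ ?_) <;> simp [abs_of_pos hr0] <;> linarith
  exact absurd h3 (not_le.2 h4)

end Convergence

/-! ### Existence, uniqueness and convergence -/

/-- If the upper relaxed limit is at most the lower one, the family converges locally uniformly. -/
theorem IsLocallyBoundedFamily.tendstoLocallyUniformlyOn {f : ℝ → ℝ × ℝ → ℝ}
    (hf : IsLocallyBoundedFamily f)
    (hle : ∀ x ∈ closedQuadrant, upperRelaxedLimit f x ≤ -upperRelaxedLimit (fun h y => -f h y) x)
    (hcont : ContinuousOn (upperRelaxedLimit f) closedQuadrant) :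
    TendstoLocallyUniformlyOn f (upperRelaxedLimit f) (𝓝[>] 0) closedQuadrant := by
  refine Metric.tendstoLocallyUniformlyOn_iff.2 fun ε hε x hx => ?_
  have h1 := hf.eventually_lt hx (lt_add_of_pos_right (upperRelaxedLimit f x) (half_pos hε))
  have h2 := hf.neg.eventually_lt hx
    (lt_add_of_pos_right (upperRelaxedLimit (fun h y => -f h y) x) (half_pos hε))
  obtain ⟨P, hP, P', hP', h⟩ := eventually_prod_iff.1 (h1.and h2)
  have h3 := Metric.tendsto_nhds.1 (hcont x hx) (ε / 2) (half_pos hε)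
  refine ⟨_, hP'.and h3, ?_⟩
  filter_upwards [hP] with k hk y hy
  obtain ⟨h4, h5⟩ := h hk hy.1
  have h6 := abs_lt.1 hy.2
  have h7 := hle x hx
  rw [Real.dist_eq, abs_lt]
  constructor <;> linarith

theorem mainTheorem8 (μ μs σ : ℝ × ℝ → ℝ)
    (hμ_nonneg : ∀ x ∈ closedQuadrant, 0 ≤ μ x)
    (hμ_lip : ∃ K : NNReal, LipschitzOnWith K μ closedQuadrant)
    (hσ_lip : ∃ K : NNReal, LipschitzOnWith K (fun x => σ x ^ 2) closedQuadrant)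
    (hzeros : {x ∈ openQuadrant | σ x = 0} ⊆ {x ∈ openQuadrant | μ x = 0})
    (hμs : IsAdmissibleSource μs) :
    (∃ U : ℝ × ℝ → ℝ,
      IsMonotoneViscositySolution μ μs σ U ∧
      (∀ V : ℝ × ℝ → ℝ, IsMonotoneViscositySolution μ μs σ V → EqOn V U closedQuadrant) ∧
      TendstoLocallyUniformlyOn (fun h : ℝ => schemeExtension μ μs σ h) U (𝓝[>] 0)
        closedQuadrant) ∧
    SchemeHasLinearComplexity := by
  refine ⟨?_, schemeHasLinearComplexity⟩
  have hμ : ContinuousOn μ closedQuadrant := let ⟨_, hK⟩ := hμ_lip; hK.continuousOn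
  have hσ : ContinuousOn (fun x => σ x ^ 2) closedQuadrant :=
    let ⟨_, hK⟩ := hσ_lip; hK.continuousOn
  have hz : ∀ x ∈ openQuadrant, σ x = 0 → μ x = 0 := fun x hx h => (hzeros ⟨hx, h⟩).2
  have hb := isLocallyBoundedFamily_schemeExtension hμ_nonneg hμ_lip hσ hμs
  have hw := fun (y : ℝ × ℝ) hy => totalWeight_nonneg (x := y) hμ_nonneg hμs hy
  set U := upperRelaxedLimit (schemeExtension μ μs σ) with hU
  set W : ℝ × ℝ → ℝ :=
    fun x => -upperRelaxedLimit (fun h y => -schemeExtension μ μs σ h y) x with hW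
  have hUsc : UpperSemicontinuousOn U closedQuadrant := hb.upperSemicontinuousOn
  have hWsc : LowerSemicontinuousOn W closedQuadrant := hb.neg.upperSemicontinuousOn.neg
  have hWmono : MonotoneOn W closedQuadrant :=
    monotoneOn_neg_upperRelaxedLimit_neg hb fun h hh => monotoneOn_schemeExtension hw hh
  have hUb : ∀ x ∈ quadrantBoundary, U x ≤ boundaryDatum μ μs x := fun x hx =>
    upperRelaxedLimit_schemeExtension_le_boundaryDatum hμ_nonneg hμ_lip hσ hμs hx
  have hWb : ∀ x ∈ quadrantBoundary, boundaryDatum μ μs x ≤ W x := fun x hx =>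
    boundaryDatum_le_lowerRelaxedLimit_schemeExtension hμ_nonneg hμ_lip hσ hμs hx
  have hsub : ∀ x ∈ openQuadrant, ∀ p, IsSuperdifferential openQuadrant U x p →
      hamiltonian μ σ x p ≤ 0 :=
    fun x hx p hp => hamiltonian_nonpos_of_isSuperdifferential hμ hσ hb hx hp
  have hsup : ∀ x ∈ openQuadrant, ∀ p, IsSubdifferential openQuadrant W x p →
      0 ≤ hamiltonian μ σ x p :=
    fun x hx p hp => hamiltonian_nonneg_of_isSubdifferential hμ hσ hb hx hp
  have hUW : ∀ x ∈ closedQuadrant, U x ≤ W x :=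
    le_of_subsolution_of_supersolution hμ_nonneg hμ_lip hσ_lip hz hUsc hWsc hWmono hsub hsup
      fun x hx => (hUb x hx).trans (hWb x hx)
  have hWU : EqOn W U closedQuadrant := fun x hx =>
    le_antisymm (hb.neg_upperRelaxedLimit_neg_le hx) (hUW x hx)
  have hUlsc : LowerSemicontinuousOn U closedQuadrant := by
    intro x hx c hc
    have hc' : c < W x := lt_of_lt_of_eq hc (hWU hx).symm
    filter_upwards [hWsc x hx c hc', self_mem_nhdsWithin] with y hy hyQ
    exact lt_of_lt_of_eq hy (hWU hyQ)
  have hUcont : ContinuousOn U closedQuadrant :=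
    continuousOn_iff_lower_upperSemicontinuousOn.2 ⟨hUlsc, hUsc⟩
  have hUsup : ∀ x ∈ openQuadrant, ∀ p, IsSubdifferential openQuadrant U x p →
      0 ≤ hamiltonian μ σ x p := by
    intro x hx p hp
    refine hsup x hx p fun ε hε => ?_
    filter_upwards [hp ε hε, self_mem_nhdsWithin] with y hy hyO
    rwa [hWU (openQuadrant_subset_closedQuadrant hx), hWU (openQuadrant_subset_closedQuadrant hyO)]
  have hOQ := openQuadrant_subset_closedQuadrant
  have hbd : ∀ x ∈ quadrantBoundary, U x = boundaryDatum μ μs x := fun x hx =>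
    le_antisymm (hUb x hx)
      ((hWb x hx).trans_eq (hWU (quadrantBoundary_subset_closedQuadrant hx)))
  refine ⟨U, ⟨hWmono.congr hWU, hUcont, ⟨?_, ?_⟩, hbd⟩, fun V hV x hx => ?_,
    hb.tendstoLocallyUniformlyOn hUW hUcont⟩
  · exact (isViscositySubsolution_hamiltonian_iff hμ hσ).2 ⟨hUsc.mono hOQ, hsub⟩
  · exact (isViscositySupersolution_hamiltonian_iff hμ hσ).2
      ⟨hUlsc.mono hOQ, hUsup⟩
  · have hVsub := ((isViscositySubsolution_hamiltonian_iff hμ hσ).1 hV.solves.1).2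
    have hVsup := ((isViscositySupersolution_hamiltonian_iff hμ hσ).1 hV.solves.2).2
    have hVU : ∀ x ∈ quadrantBoundary, V x = U x := fun x hx =>
      (hV.boundary x hx).trans (hbd x hx).symm
    refine le_antisymm ?_ ?_
    · exact le_of_subsolution_of_supersolution hμ_nonneg hμ_lip hσ_lip hz
        hV.continuous.upperSemicontinuousOn hUlsc (hWmono.congr hWU)
        hVsub hUsup (fun x hx => (hVU x hx).le) x hx
    · exact le_of_subsolution_of_supersolution hμ_nonneg hμ_lip hσ_lip hz
        hUsc hV.continuous.lowerSemicontinuousOn hV.monotone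
        hsub hVsup (fun x hx => (hVU x hx).ge) x hx
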